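/- Fix $p\ge 2$, a unit vector ${\pmb\theta}_1^0\in\mathbb R^p$, $v>0$ and a bounded positive real sequence $(r_n)_{n\ge1}$. For each $n\geq 1$, let $\mathbf X_{n1},\dots,\mathbf X_{nn}$ be a random sample from the $p$-variate normal distribution with mean zero and covariance matrix $\mathbf I_p+r_n v\,{\pmb\theta}_1^0{\pmb\theta}_1^{0\prime}$. Let $\bar{\mathbf X}_n=\frac1n\sum_{i=1}^n\mathbf X_{ni}$ and $\mathbf S_n=\frac1n\sum_{i=1}^n(\mathbf X_{ni}-\bar{\mathbf X}_n)(\mathbf X_{ni}-\bar{\mathbf X}_n)'$, let $\hat\lambda_{n1}$ be the largest eigenvalue of $\mathbf S_n$, and let $$Q_{\rm A}=Q_{\rm A}^{(n)}=n\big(\hat\lambda_{n1}\,{\pmb\theta}_1^{0\prime}\mathbf S_n^{-1}{\pmb\theta}_1^0+\hat\lambda_{n1}^{-1}\,{\pmb\theta}_1^{0\prime}\mathbf S_n{\pmb\theta}_1^0-2\big)$$ be the Anderson test statistic. For $\alpha\in(0,1)$, the Anderson test at nominal level $\alpha$ rejects when $Q_{\rm A}>\chi^2_{p-1,1-\alpha}$,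 the $\alpha$-upper quantile of the chi-square distribution with $p-1$ degrees of freedom; it has asymptotic size $\alpha$ if its rejection probability under the distributions above converges to $\alpha$ as $n\to\infty$. Let $\mathbf Z$ be a $p\times p$ random matrix with ${\rm vec}(\mathbf Z)\sim\mathcal N(\mathbf 0,\mathbf I_{p^2}+\mathbf K_p)$, where $\mathbf K_p$ is the commutation matrix, i.e. $\mathbf K_p\,{\rm vec}(\mathbf A)={\rm vec}(\mathbf A')$ for every $p\times p$ matrix $\mathbf A$ (so that $\mathbf Z$ is almost surely symmetric). Then, as $n\to\infty$: * (i)–(ii) If $r_n\equiv1$, or if $r_n\to0$ with $\sqrt n\,r_n\to\infty$, then $Q_{\rm A}$ converges in distribution to $\chi^2_{p-1}$, and, for every $\alpha\in(0,1)$, the Anderson test has asymptotic size $\alpha$. * (iii) If $r_n=1/\sqrt n$, then $Q_{\rm A}$ converges in distribution to $$\sum_{j=2}^p(\ell_1(v)-\ell_j(v))^2\,(w_{j1}(v))^2,$$ where $\ell_1(v)\ge\dots\ge\ell_p(v)$ are the eigenvalues of $\mathbf Z+{\rm diag}(v,0,\dots,0)$ and $\mathbf w_j(v)=(w_{j1}(v),\dots,w_{jp}(v))'$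 is an arbitrary unit eigenvector associated with $\ell_j(v)$; with probability one, each $\mathbf w_j(v)$ is unique up to a sign. For every $\alpha\in(0,1)$, the Anderson test does not have asymptotic size $\alpha$. * (iv) If $r_n=o(1/\sqrt n)$, then $Q_{\rm A}$ converges in distribution to $\sum_{j=2}^p(\ell_1-\ell_j)^2w_{j1}^2$, where $\ell_1\ge\dots\ge\ell_p$ are the eigenvalues of $\mathbf Z$ and $\mathbf w_j=(w_{j1},\dots,w_{jp})'$ is an arbitrary unit eigenvector associated with $\ell_j$. For every $\alpha\in(0,1)$, the Anderson test does not have asymptotic size $\alpha$. -/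

import Mathlib

open MeasureTheory ProbabilityTheory Filter Matrix
open scoped Topology Asymptotics

namespace AndersonPCA

noncomputable section

/-- The eigenvalues of a real symmetric matrix, repeated according to multiplicity and listed in
decreasing order: index `0` carries the largest one. Matrices that are not symmetric get the
default value `0`. -/
def eigval {p : ℕ} (A : Matrix (Fin p) (Fin p) ℝ) (j : Fin p) : ℝ :=
  open scoped Classical in
  if h : A.IsHermitian then h.eigenvalues₀ (Fin.cast (Fintype.card_fin p).symm j) else 0

/-- `u` is a unit eigenvector of `A` associated with the eigenvalue `c`. -/
def IsUnitEigenvector {p : ℕ} (A : Matrix (Fin p) (Fin p) ℝ) (c : ℝ)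
    (u : EuclideanSpace ℝ (Fin p)) : Prop :=
  ‖u‖ = 1 ∧ A *ᵥ u.ofLp = c • u.ofLp

/-- The commutation matrix `K_p`, indexed by pairs like the vectorization `Matrix.vec`. -/
def commutationMatrix (p : ℕ) : Matrix (Fin p × Fin p) (Fin p × Fin p) ℝ :=
  Matrix.of fun a b => if a = b.swap then 1 else 0

/-- The defining property of the commutation matrix: `K_p (vec A) = vec Aᵀ`. -/
theorem commutationMatrix_mulVec_vec {p : ℕ} (A : Matrix (Fin p) (Fin p) ℝ) :
    commutationMatrix p *ᵥ A.vec = Aᵀ.vec := by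
  ext ⟨i, j⟩
  rw [Matrix.mulVec, dotProduct, Finset.sum_eq_single (j, i)]
  · simp [commutationMatrix, Matrix.vec]
  · rintro ⟨a, b⟩ - hab
    have : ¬ ((i, j) = (a, b).swap) := by
      intro h
      apply hab
      simp only [Prod.swap_prod_mk, Prod.mk.injEq] at h
      simp [h.1, h.2]
    simp only [commutationMatrix, Matrix.of_apply, if_neg this, zero_mul]
  · simp

/-- The single-spiked covariance matrix `I_p + r v θ θ'`. -/
def spikedCov {p : ℕ} (θ : EuclideanSpace ℝ (Fin p)) (r v : ℝ) : Matrix (Fin p) (Fin p) ℝ :=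
  1 + (r * v) • Matrix.vecMulVec θ.ofLp θ.ofLp

/-- The law of a random sample of size `n` from the `p`-variate normal distribution with mean zero
and covariance matrix `I_p + r v θ θ'`. -/
def sampleLaw {p : ℕ} (n : ℕ) (θ : EuclideanSpace ℝ (Fin p)) (r v : ℝ) :
    Measure (Fin n → EuclideanSpace ℝ (Fin p)) :=
  Measure.pi fun _ => multivariateGaussian 0 (spikedCov θ r v)

instance {p : ℕ} (n : ℕ) (θ : EuclideanSpace ℝ (Fin p)) (r v : ℝ) :
    IsProbabilityMeasure (sampleLaw n θ r v) := by
  unfold sampleLaw; infer_instance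

/-- The sample average. -/
def sampleMean {p n : ℕ} (x : Fin n → EuclideanSpace ℝ (Fin p)) : EuclideanSpace ℝ (Fin p) :=
  (1 / n : ℝ) • ∑ i, x i

/-- The sample covariance matrix (with divisor `n`). -/
def sampleCov {p n : ℕ} (x : Fin n → EuclideanSpace ℝ (Fin p)) : Matrix (Fin p) (Fin p) ℝ :=
  (1 / n : ℝ) •
    ∑ i, Matrix.vecMulVec (x i - sampleMean x).ofLp (x i - sampleMean x).ofLp

/-- The Anderson test statistic `n (λ̂₁ θ' S⁻¹ θ + λ̂₁⁻¹ θ' S θ - 2)`, where `S` is the sample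
covariance matrix and `λ̂₁` its largest eigenvalue. -/
def QA {p : ℕ} [NeZero p] (n : ℕ) (θ : EuclideanSpace ℝ (Fin p))
    (x : Fin n → EuclideanSpace ℝ (Fin p)) : ℝ :=
  n * (eigval (sampleCov x) 0 * (θ.ofLp ⬝ᵥ ((sampleCov x)⁻¹ *ᵥ θ.ofLp))
    + (eigval (sampleCov x) 0)⁻¹ * (θ.ofLp ⬝ᵥ (sampleCov x *ᵥ θ.ofLp)) - 2)

/-- The chi-square distribution with `k` degrees of freedom: the law of the sum of the squares of
`k` independent standard normal random variables. -/
def chiSquare (k : ℕ) : Measure ℝ :=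
  (Measure.pi fun _ : Fin k => gaussianReal 0 1).map fun x => ∑ i, x i ^ 2

instance (k : ℕ) : IsProbabilityMeasure (chiSquare k) :=
  Measure.isProbabilityMeasure_map
    (Measurable.aemeasurable (Finset.measurable_sum _ fun i _ => (measurable_pi_apply i).pow_const 2))

/-- The `α`-upper quantile of the chi-square distribution with `k` degrees of freedom. -/
def chiSquareUpperQuantile (k : ℕ) (α : ℝ) : ℝ :=
  sInf {x : ℝ | 1 - α ≤ cdf (chiSquare k) x}

/-- The Anderson test at nominal level `α`, which rejects when
`Q_A` exceeds the `α`-upper quantile of the chi-square distribution with `p - 1` degrees of freedom,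
has asymptotic size `α` along the null hypotheses given by `θ`, `v` and the sequence `r`:
its rejection probability converges to `α`. -/
def AndersonHasAsymptoticSize {p : ℕ} [NeZero p] (θ : EuclideanSpace ℝ (Fin p)) (r : ℕ → ℝ)
    (v α : ℝ) : Prop :=
  Tendsto (fun n : ℕ =>
      (sampleLaw n θ (r n) v).real {x | chiSquareUpperQuantile (p - 1) α < QA n θ x})
    atTop (𝓝 α)

/-- The matrix `Z + diag(v, 0, …, 0)`. -/
def spiked {p : ℕ} [NeZero p] (Z : Matrix (Fin p) (Fin p) ℝ) (v : ℝ) :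
    Matrix (Fin p) (Fin p) ℝ :=
  Z + Matrix.diagonal (Pi.single 0 v)

/-- The quantity `∑_{j ≥ 2} (ℓ₁ - ℓⱼ)² (wⱼ₁)²` built from the ordered eigenvalues `ℓⱼ` of `A` and a
family of vectors `wⱼ`. -/
def andersonLimit {p : ℕ} [NeZero p] (A : Matrix (Fin p) (Fin p) ℝ)
    (w : Fin p → EuclideanSpace ℝ (Fin p)) : ℝ :=
  ∑ j ∈ Finset.univ.erase 0, (eigval A 0 - eigval A j) ^ 2 * (w j 0) ^ 2

end

end AndersonPCA

/-! Write `λ` for the largest eigenvalue of a symmetric invertible matrix `A` and `e` for the first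
basis vector. Since `(λ - A) A⁻¹ (λ - A) = λ² A⁻¹ - 2λ + A`, the Anderson statistic equals `λ⁻¹ y'
A⁻¹ y`, where `y = √n (λ - A) e` measures how far `e` is from being a top eigenvector
(`andersonStat_eq`). A rotation sends `θ` to `e`, and the sample is a linear image of standard
Gaussian vectors, so that `A = D (I + T / √n) D` with `D = diag(√(1 + ρ), 1, …, 1)`, `ρ = r v` and
`T = √n (S - I)`, `S` being the covariance matrix of the standard sample. By the central limit
theorem `T` converges to `Z`. The statistic is thus a deterministic function, depending on `n`, of
`T`, and the extended continuous mapping theorem reduces every regime to a deterministic limit along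
`T → z`.

If `√n ρ → κ`, then `A → I` and `√n (A - I) → W = z + diag(κ, 0, …, 0)`. The top eigenvalue commutes
with `W ↦ I + ε W` for `ε ≥ 0`, so the limit is `‖(ℓ₁ - W) e‖²`. Parseval's identity in an
eigenbasis of `W` gives the stated sum. The spectrum of the random `W` is almost surely simple,
because its discriminant is a polynomial that is not identically zero.

If `√n ρ → ∞`, the spectral gap, of order `ρ`, makes `λ - A₁₁` of order `1 / (n ρ)`. The first
coordinate of `y` then vanishes in the limit, and only the off-diagonal first column of `z`
survives, normalized to unit variance: this is a chi-square variable with `p - 1` degrees of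
freedom.

The limit under contiguity is that same chi-square variable plus the square `(ℓ₁ - W₁₁)²`. It
exceeds any positive level with strictly larger probability, so the test cannot have the nominal
size (`chiSquare_Ioi_lt`). -/

namespace AndersonPCA

noncomputable section

/-! ### Eigenbases and the largest eigenvalue -/

/-- A real symmetric matrix has an orthonormal basis of eigenvectors, ordered as `eigval`. -/
theorem exists_eigenbasis {p : ℕ} {A : Matrix (Fin p) (Fin p) ℝ} (hA : A.IsHermitian) :
    ∃ b : OrthonormalBasis (Fin p) ℝ (EuclideanSpace ℝ (Fin p)),
      (∀ j, A *ᵥ (b j).ofLp = eigval A j • (b j).ofLp) ∧ Antitone (eigval A) := by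
  classical
  refine ⟨((isSymmetric_toEuclideanLin_iff.mpr hA).eigenvectorBasis
    finrank_euclideanSpace).reindex (finCongr (Fintype.card_fin p)), fun j => ?_, ?_⟩
  · have h := (isSymmetric_toEuclideanLin_iff.mpr hA).apply_eigenvectorBasis
      finrank_euclideanSpace (Fin.cast (Fintype.card_fin p).symm j)
    have h' := congrArg WithLp.ofLp h
    simp only [OrthonormalBasis.reindex_apply, eigval, dif_pos hA]
    simpa only [IsHermitian.eigenvalues₀, toLpLin_apply] using! h'
  · intro i j hij
    simp only [eigval, dif_pos hA]
    exact hA.eigenvalues₀_antitone (Fin.le_def.mpr hij)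

theorem inner_eq_dotProduct {ι : Type*} [Fintype ι] (x y : EuclideanSpace ℝ ι) :
    inner ℝ x y = x.ofLp ⬝ᵥ y.ofLp := by
  rw [EuclideanSpace.inner_eq_star_dotProduct, dotProduct_comm]; simp

/-- The quadratic form of a symmetric matrix in an orthonormal basis of eigenvectors. -/
theorem dotProduct_mulVec_eq_sum {p : ℕ} {A : Matrix (Fin p) (Fin p) ℝ} {c : Fin p → ℝ}
    (hA : A.IsHermitian)
    (b : OrthonormalBasis (Fin p) ℝ (EuclideanSpace ℝ (Fin p)))
    (hb : ∀ j, A *ᵥ (b j).ofLp = c j • (b j).ofLp) (x : EuclideanSpace ℝ (Fin p)) :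
    x.ofLp ⬝ᵥ (A *ᵥ x.ofLp) = ∑ j, c j * inner ℝ (b j) x ^ 2 := by
  have h1 : x.ofLp ⬝ᵥ (A *ᵥ x.ofLp) = inner ℝ x (WithLp.toLp 2 (A *ᵥ x.ofLp)) := by
    rw [inner_eq_dotProduct]
  have h2 : ∀ j, inner ℝ (b j) (WithLp.toLp 2 (A *ᵥ x.ofLp)) = c j * inner ℝ (b j) x := by
    intro j
    rw [inner_eq_dotProduct, inner_eq_dotProduct, dotProduct_mulVec, ← mulVec_transpose,
      show Aᵀ = A from by simpa [IsHermitian] using hA, hb]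
    simp
  rw [h1, ← b.sum_inner_mul_inner x]
  refine Finset.sum_congr rfl fun j _ => ?_
  rw [h2, real_inner_comm]; ring

/-- The supremum of the quadratic form of a matrix over the unit sphere. -/
def topEig {p : ℕ} (A : Matrix (Fin p) (Fin p) ℝ) : ℝ :=
  sSup ((fun x : EuclideanSpace ℝ (Fin p) => x.ofLp ⬝ᵥ (A *ᵥ x.ofLp)) '' Metric.sphere 0 1)

theorem continuous_quadForm {p : ℕ} :
    Continuous fun q : Matrix (Fin p) (Fin p) ℝ × EuclideanSpace ℝ (Fin p) =>
      q.2.ofLp ⬝ᵥ (q.1 *ᵥ q.2.ofLp) := by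
  have : Continuous fun q : Matrix (Fin p) (Fin p) ℝ × EuclideanSpace ℝ (Fin p) => q.2.ofLp := by
    fun_prop
  exact this.dotProduct (continuous_fst.matrix_mulVec this)

/-- A supremum of a jointly continuous function over a compact set depends continuously on the
parameter. This is why `topEig` replaces `eigval A 0`, whose definition by cases is not continuous
on all matrices. -/
theorem continuous_topEig {p : ℕ} : Continuous (topEig (p := p)) :=
  (isCompact_sphere (0 : EuclideanSpace ℝ (Fin p)) 1).continuous_sSup
    (f := fun A x => x.ofLp ⬝ᵥ (A *ᵥ x.ofLp)) continuous_quadForm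

theorem le_topEig {p : ℕ} (A : Matrix (Fin p) (Fin p) ℝ) {x : EuclideanSpace ℝ (Fin p)}
    (hx : ‖x‖ = 1) : x.ofLp ⬝ᵥ (A *ᵥ x.ofLp) ≤ topEig A := by
  refine le_csSup ?_ ⟨x, by simpa using hx, rfl⟩
  refine ((isCompact_sphere (0 : EuclideanSpace ℝ (Fin p)) 1).image ?_).bddAbove
  exact continuous_quadForm.comp (Continuous.prodMk_right A)

section

variable {p : ℕ} [NeZero p]

theorem norm_single_zero : ‖EuclideanSpace.single (0 : Fin p) (1 : ℝ)‖ = 1 := by simp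

theorem topEig_le {A : Matrix (Fin p) (Fin p) ℝ} {c : ℝ}
    (h : ∀ x : EuclideanSpace ℝ (Fin p), ‖x‖ = 1 → x.ofLp ⬝ᵥ (A *ᵥ x.ofLp) ≤ c) :
    topEig A ≤ c := by
  refine csSup_le ?_ ?_
  · exact ⟨_, EuclideanSpace.single 0 1, by simp, rfl⟩
  · rintro _ ⟨x, hx, rfl⟩
    exact h x (by simpa using hx)

theorem apply_zero_zero_le_topEig (A : Matrix (Fin p) (Fin p) ℝ) : A 0 0 ≤ topEig A := by
  simpa using le_topEig A (norm_single_zero (p := p))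

/-- On the unit sphere the identity contributes the constant 1. The formula is exact, so no
perturbation expansion of eigenvalues is needed under contiguity. -/
theorem topEig_one_add_smul (W : Matrix (Fin p) (Fin p) ℝ) {ε : ℝ} (hε : 0 ≤ ε) :
    topEig (1 + ε • W) = 1 + ε * topEig W := by
  have key : ∀ x : EuclideanSpace ℝ (Fin p), ‖x‖ = 1 →
      x.ofLp ⬝ᵥ ((1 + ε • W) *ᵥ x.ofLp) = 1 + ε * (x.ofLp ⬝ᵥ (W *ᵥ x.ofLp)) := by
    intro x hx
    have : x.ofLp ⬝ᵥ x.ofLp = 1 := by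
      rw [← inner_eq_dotProduct, real_inner_self_eq_norm_sq, hx]; norm_num
    rw [add_mulVec, dotProduct_add, smul_mulVec, dotProduct_smul, one_mulVec, this, smul_eq_mul]
  refine le_antisymm (topEig_le fun x hx => ?_) ?_
  · rw [key x hx]
    have := le_topEig W hx
    gcongr
  · rcases hε.eq_or_lt with rfl | hε
    · have := le_topEig (1 + (0 : ℝ) • W) (norm_single_zero (p := p))
      rw [key _ norm_single_zero] at this
      simpa using this
    · have : topEig W ≤ (topEig (1 + ε • W) - 1) / ε := topEig_le fun x hx => by
        rw [le_div_iff₀ hε]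
        have := le_topEig (1 + ε • W) hx
        rw [key x hx] at this
        linarith
      rw [le_div_iff₀ hε] at this
      linarith

theorem topEig_eq_eigval {A : Matrix (Fin p) (Fin p) ℝ} (hA : A.IsHermitian) :
    topEig A = eigval A 0 := by
  obtain ⟨b, hb, hanti⟩ := exists_eigenbasis hA
  refine le_antisymm (topEig_le fun x hx => ?_) ?_
  · rw [dotProduct_mulVec_eq_sum hA b hb x]
    have h1 : ∑ j, inner ℝ (b j) x ^ 2 = 1 := by
      rw [b.sum_sq_inner_right, hx]; norm_num
    calc ∑ j, eigval A j * inner ℝ (b j) x ^ 2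
        ≤ ∑ j, eigval A 0 * inner ℝ (b j) x ^ 2 :=
          Finset.sum_le_sum fun j _ =>
            mul_le_mul_of_nonneg_right (hanti (Fin.zero_le j)) (sq_nonneg _)
      _ = eigval A 0 := by rw [← Finset.mul_sum, h1, mul_one]
  · have h := le_topEig A (b.norm_eq_one 0)
    have h2 : (b 0).ofLp ⬝ᵥ (b 0).ofLp = 1 := by
      rw [← inner_eq_dotProduct, real_inner_self_eq_norm_sq, b.norm_eq_one]; norm_num
    rw [hb, dotProduct_smul, h2] at h
    simpa using h

/-- Orthogonal matrices preserve the unit sphere. One inequality, applied to `R` and then to `Rᵀ`,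
gives both directions. -/
theorem topEig_mul_mul_transpose (A R : Matrix (Fin p) (Fin p) ℝ) (hR : R * Rᵀ = 1) :
    topEig (R * A * Rᵀ) = topEig A := by
  have key : ∀ (B Q : Matrix (Fin p) (Fin p) ℝ), Q * Qᵀ = 1 → topEig (Q * B * Qᵀ) ≤ topEig B := by
    intro B Q hQ
    refine topEig_le fun x hx => ?_
    have h1 : x.ofLp ⬝ᵥ ((Q * B * Qᵀ) *ᵥ x.ofLp) = (Qᵀ *ᵥ x.ofLp) ⬝ᵥ (B *ᵥ (Qᵀ *ᵥ x.ofLp)) := by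
      rw [← mulVec_mulVec, ← mulVec_mulVec, dotProduct_mulVec, ← mulVec_transpose]
    rw [h1]
    refine le_topEig B (x := WithLp.toLp 2 (Qᵀ *ᵥ x.ofLp)) ?_
    have h2 : ‖WithLp.toLp 2 (Qᵀ *ᵥ x.ofLp)‖ ^ 2 = 1 := by
      rw [← real_inner_self_eq_norm_sq, inner_eq_dotProduct, dotProduct_mulVec, ← mulVec_transpose,
        transpose_transpose, mulVec_mulVec, hQ, one_mulVec, ← inner_eq_dotProduct,
        real_inner_self_eq_norm_sq, hx, one_pow]
    nlinarith [norm_nonneg (WithLp.toLp 2 (Qᵀ *ᵥ x.ofLp) : EuclideanSpace ℝ (Fin p))]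
  have hR' : Rᵀ * R = 1 := mul_eq_one_comm.mp hR
  refine le_antisymm (key A R hR) ?_
  have := key (R * A * Rᵀ) Rᵀ (by rwa [transpose_transpose])
  rwa [transpose_transpose, show Rᵀ * (R * A * Rᵀ) * R = (Rᵀ * R) * A * (Rᵀ * R) by
    simp only [Matrix.mul_assoc], hR', Matrix.one_mul, Matrix.mul_one] at this

end

/-- When the spectrum is simple, unit eigenvectors agree up to a sign with those of a basis. -/
theorem IsUnitEigenvector.eq_or_eq_neg_basis {p : ℕ} {A : Matrix (Fin p) (Fin p) ℝ}
    (hA : A.IsHermitian) (hinj : Function.Injective (eigval A))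
    {b : OrthonormalBasis (Fin p) ℝ (EuclideanSpace ℝ (Fin p))}
    (hb : ∀ j, A *ᵥ (b j).ofLp = eigval A j • (b j).ofLp) {j : Fin p}
    {u : EuclideanSpace ℝ (Fin p)} (hu : IsUnitEigenvector A (eigval A j) u) :
    u = b j ∨ u = -b j := by
  have horth : ∀ k, k ≠ j → inner ℝ (b k) u = 0 := by
    intro k hk
    have h1 : (b k).ofLp ⬝ᵥ (A *ᵥ u.ofLp) = eigval A j * inner ℝ (b k) u := by
      rw [hu.2, dotProduct_smul, inner_eq_dotProduct, smul_eq_mul]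
    have h2 : (b k).ofLp ⬝ᵥ (A *ᵥ u.ofLp) = eigval A k * inner ℝ (b k) u := by
      rw [dotProduct_mulVec, ← mulVec_transpose, show Aᵀ = A from by simpa [IsHermitian] using hA,
        hb, smul_dotProduct, inner_eq_dotProduct, smul_eq_mul]
    have h3 : (eigval A j - eigval A k) * inner ℝ (b k) u = 0 := by
      rw [sub_mul, ← h1, ← h2, sub_self]
    rcases mul_eq_zero.mp h3 with h | h
    · exact absurd (hinj (sub_eq_zero.mp h)).symm hk
    · exact h
  have hexp : u = inner ℝ (b j) u • b j := by
    conv_lhs => rw [← b.sum_repr' u]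
    rw [Finset.sum_eq_single j (fun k _ hk => by rw [horth k hk, zero_smul]) (by simp)]
  have hn : |inner ℝ (b j) u| = 1 := by
    have := congrArg norm hexp
    rw [norm_smul, b.norm_eq_one, mul_one, hu.1] at this
    simpa using this.symm
  rcases (abs_eq one_pos.le).mp hn with h | h
  · left; rw [h, one_smul] at hexp; exact hexp
  · right; rw [h, neg_smul, one_smul] at hexp; exact hexp

/-! ### The limit functional under contiguity -/

/-- `‖(ℓ₁ - A) e₁‖²`, with `ℓ₁` the largest eigenvalue. -/
def limitStat {p : ℕ} [NeZero p] (A : Matrix (Fin p) (Fin p) ℝ) : ℝ :=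
  (topEig A - A 0 0) ^ 2 + ∑ j ∈ Finset.univ.erase 0, A j 0 ^ 2

theorem continuous_limitStat {p : ℕ} [NeZero p] : Continuous (limitStat (p := p)) := by
  have := continuous_topEig (p := p)
  unfold limitStat
  fun_prop

/-- Both sides compute `‖(ℓ₁ - A) e₁‖²`, one in an eigenbasis and the other in the standard basis.
The eigenvectors enter through squares only, so their signs are immaterial. -/
theorem andersonLimit_eq_limitStat {p : ℕ} [NeZero p] {A : Matrix (Fin p) (Fin p) ℝ}
    (hA : A.IsHermitian) (hinj : Function.Injective (eigval A))
    {w : Fin p → EuclideanSpace ℝ (Fin p)} (hw : ∀ j, IsUnitEigenvector A (eigval A j) (w j)) :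
    andersonLimit A w = limitStat A := by
  obtain ⟨b, hb, -⟩ := exists_eigenbasis hA
  have hsq : ∀ j, (w j 0) ^ 2 = (b j 0) ^ 2 := by
    intro j
    rcases (hw j).eq_or_eq_neg_basis hA hinj hb with h | h <;> simp [h]
  set y : EuclideanSpace ℝ (Fin p) :=
    WithLp.toLp 2 ((topEig A • (1 : Matrix (Fin p) (Fin p) ℝ) - A) *ᵥ Pi.single 0 1) with hy
  have hy0 : y 0 = topEig A - A 0 0 := by simp [hy]
  have hyj : ∀ j, j ≠ 0 → y j = - A j 0 := by
    intro j hj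
    simp [hy, hj]
  have h1 : ‖y‖ ^ 2 = limitStat A := by
    rw [EuclideanSpace.real_norm_sq_eq, ← Finset.add_sum_erase _ _ (Finset.mem_univ 0), limitStat,
      hy0]
    congr 1
    refine Finset.sum_congr rfl fun j hj => ?_
    rw [hyj j (Finset.ne_of_mem_erase hj), neg_sq]
  have h2 : ∀ j, inner ℝ (b j) y = (eigval A 0 - eigval A j) * b j 0 := by
    intro j
    have hA' : Aᵀ = A := by simpa [IsHermitian] using hA
    rw [inner_eq_dotProduct, hy, dotProduct_mulVec, ← mulVec_transpose, transpose_sub,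
      transpose_smul, transpose_one, hA', sub_mulVec, smul_mulVec, one_mulVec, hb,
      topEig_eq_eigval hA]
    simp [sub_mul]
  rw [← h1, ← b.sum_sq_inner_right, andersonLimit]
  rw [← Finset.add_sum_erase _ _ (Finset.mem_univ 0)]
  rw [h2 0]
  simp only [sub_self, zero_mul, ne_eq, OfNat.ofNat_ne_zero, not_false_eq_true, zero_pow, zero_add]
  refine Finset.sum_congr rfl fun j _ => ?_
  rw [h2, hsq, mul_pow]

/-! ### Simple spectrum and the discriminant -/

/-- The matrix of power sums of the eigenvalues, whose determinant is the discriminant of the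
characteristic polynomial. -/
def powerTraces {R : Type*} [CommRing R] {p : ℕ} (A : Matrix (Fin p) (Fin p) R) :
    Matrix (Fin p) (Fin p) R :=
  Matrix.of fun i j => (A ^ ((i : ℕ) + (j : ℕ))).trace

theorem trace_pow_eq_sum_eigval {p : ℕ} {A : Matrix (Fin p) (Fin p) ℝ}
    (hA : A.IsHermitian) (k : ℕ) : (A ^ k).trace = ∑ j, eigval A j ^ k := by
  obtain ⟨b, hb, -⟩ := exists_eigenbasis hA
  have hpow : ∀ (k : ℕ) j, (A ^ k) *ᵥ (b j).ofLp = eigval A j ^ k • (b j).ofLp := by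
    intro k j
    induction k with
    | zero => simp
    | succ k ih =>
      rw [pow_succ, ← mulVec_mulVec, hb, mulVec_smul, ih, smul_smul, pow_succ, mul_comm]
  have h := LinearMap.trace_eq_sum_inner (toEuclideanLin (A ^ k)) b
  have h' : (A ^ k).trace = LinearMap.trace ℝ _ (toEuclideanLin (A ^ k)) := by
    rw [toEuclideanLin_eq_toLin_orthonormal, Matrix.trace_toLin_eq]
  rw [h', h]
  refine Finset.sum_congr rfl fun j _ => ?_
  have : (toEuclideanLin (A ^ k)) (b j) = eigval A j ^ k • b j := by
    ext i
    exact congrFun (hpow k j) i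
  rw [this, inner_smul_right, real_inner_self_eq_norm_sq, b.norm_eq_one]; simp

/-- The matrix of power sums is `VᵀV` for the Vandermonde matrix `V` of the eigenvalues. Simplicity
of the spectrum thereby becomes the nonvanishing of a polynomial in the entries of `A`. -/
theorem eigval_injective_iff {p : ℕ} {A : Matrix (Fin p) (Fin p) ℝ} (hA : A.IsHermitian) :
    Function.Injective (eigval A) ↔ (powerTraces A).det ≠ 0 := by
  have : powerTraces A = (vandermonde (eigval A))ᵀ * vandermonde (eigval A) := by
    ext i j
    rw [powerTraces, of_apply, trace_pow_eq_sum_eigval hA]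
    simp [mul_apply, vandermonde_apply, pow_add]
  rw [this, det_mul, det_transpose, ← det_vandermonde_ne_zero_iff]
  simp

theorem powerTraces_map {R S : Type*} [CommRing R] [CommRing S] (f : R →+* S) {p : ℕ}
    (A : Matrix (Fin p) (Fin p) R) : powerTraces (A.map f) = (powerTraces A).map f := by
  ext i j
  simp [powerTraces, ← RingHom.mapMatrix_apply, ← map_pow, AddMonoidHom.map_trace]

/-! ### Deterministic limits of the Anderson statistic -/

theorem tendsto_matrix_inv {p : ℕ} {ι : Type*} {l : Filter ι} {A : ι → Matrix (Fin p) (Fin p) ℝ}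
    {B : Matrix (Fin p) (Fin p) ℝ} (hA : Tendsto A l (𝓝 B)) (hB : B.det ≠ 0) :
    Tendsto (fun i => (A i)⁻¹) l (𝓝 B⁻¹) := by
  simp only [inv_def, Ring.inverse_eq_inv']
  have h1 : Tendsto (fun i => (A i).det) l (𝓝 B.det) :=
    ((continuous_id.matrix_det).tendsto B).comp hA
  have h2 : Tendsto (fun i => (A i).adjugate) l (𝓝 B.adjugate) :=
    ((continuous_id.matrix_adjugate).tendsto B).comp hA
  exact (h1.inv₀ hB).smul h2

theorem quadForm_le_topEig {p : ℕ} (A : Matrix (Fin p) (Fin p) ℝ) (x : Fin p → ℝ) :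
    x ⬝ᵥ (A *ᵥ x) ≤ topEig A * (x ⬝ᵥ x) := by
  have hxx : x ⬝ᵥ x = ‖WithLp.toLp 2 x‖ ^ 2 := by
    rw [← real_inner_self_eq_norm_sq, inner_eq_dotProduct]
  by_cases hx : x = 0
  · simp [hx]
  have hn : 0 < ‖WithLp.toLp 2 x‖ := norm_pos_iff.mpr (by simpa using hx)
  have := le_topEig A (x := ‖WithLp.toLp 2 x‖⁻¹ • WithLp.toLp 2 x) (by
    rw [norm_smul, norm_inv, norm_norm, inv_mul_cancel₀ hn.ne'])
  rw [WithLp.ofLp_smul, mulVec_smul, dotProduct_smul, smul_dotProduct, smul_eq_mul,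
    smul_eq_mul] at this
  rw [hxx]
  field_simp at this
  linarith

section

variable {p : ℕ} [NeZero p]

/-- The Anderson statistic of a symmetric matrix for the first coordinate direction. -/
def andersonStat (c : ℝ) (A : Matrix (Fin p) (Fin p) ℝ) : ℝ :=
  c * (topEig A * A⁻¹ 0 0 + (topEig A)⁻¹ * A 0 0 - 2)

/-- The residual `(ℓ₁ - A) e₁`. -/
def residual (A : Matrix (Fin p) (Fin p) ℝ) : Fin p → ℝ :=
  (topEig A • (1 : Matrix (Fin p) (Fin p) ℝ) - A) *ᵥ Pi.single 0 1

theorem residual_zero (A : Matrix (Fin p) (Fin p) ℝ) : residual A 0 = topEig A - A 0 0 := by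
  simp [residual]

theorem residual_of_ne {A : Matrix (Fin p) (Fin p) ℝ} {j : Fin p} (hj : j ≠ 0) :
    residual A j = - A j 0 := by
  simp [residual, hj]

/-- With `M = ℓ₁ - A`, expanding `M A⁻¹ M` gives `ℓ₁² A⁻¹ - 2ℓ₁ + A`; its `(0, 0)` entry divided by
`ℓ₁` is the statistic. The second-order cancellation is now explicit: only the rescaled residual has
to converge. -/
theorem andersonStat_eq {A : Matrix (Fin p) (Fin p) ℝ} (hA : A.IsSymm) (hdet : A.det ≠ 0)
    (htop : topEig A ≠ 0) (s : ℝ) :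
    andersonStat (s ^ 2) A = (topEig A)⁻¹ * ((s • residual A) ⬝ᵥ (A⁻¹ *ᵥ (s • residual A))) := by
  have hu : IsUnit A.det := isUnit_iff_ne_zero.mpr hdet
  set M : Matrix (Fin p) (Fin p) ℝ := topEig A • (1 : Matrix (Fin p) (Fin p) ℝ) - A with hM
  have hMT : Mᵀ = M := by rw [hM, transpose_sub, transpose_smul, transpose_one, hA.eq]
  have h1 : M * (A⁻¹ * M) = topEig A ^ 2 • A⁻¹ - (2 * topEig A) • 1 + A := by
    rw [hM]
    simp only [mul_sub, sub_mul, mul_smul_comm, smul_mul_assoc, mul_one, one_mul,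
      nonsing_inv_mul A hu, mul_nonsing_inv A hu]
    module
  have h2 : residual A ⬝ᵥ (A⁻¹ *ᵥ residual A) = (M * (A⁻¹ * M)) 0 0 := by
    have : residual A = M *ᵥ Pi.single 0 1 := rfl
    rw [this, mulVec_mulVec, dotProduct_comm, dotProduct_mulVec, ← mulVec_transpose, hMT,
      mulVec_mulVec]
    simp
  rw [mulVec_smul, smul_dotProduct, dotProduct_smul, h2, h1, andersonStat]
  simp only [Matrix.add_apply, Matrix.sub_apply, Matrix.smul_apply, one_apply_eq, smul_eq_mul]
  field_simp
  ring

theorem tendsto_andersonStat {ι : Type*} {l : Filter ι} {A : ι → Matrix (Fin p) (Fin p) ℝ}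
    {B : Matrix (Fin p) (Fin p) ℝ} {s : ι → ℝ} {y : Fin p → ℝ} (hsymm : ∀ i, (A i).IsSymm)
    (hA : Tendsto A l (𝓝 B)) (hdet : B.det ≠ 0) (htop : topEig B ≠ 0)
    (hy : Tendsto (fun i => s i • residual (A i)) l (𝓝 y)) :
    Tendsto (fun i => andersonStat (s i ^ 2) (A i)) l (𝓝 ((topEig B)⁻¹ * (y ⬝ᵥ (B⁻¹ *ᵥ y)))) := by
  have h1 : Tendsto (fun i => topEig (A i)) l (𝓝 (topEig B)) :=
    (continuous_topEig.tendsto B).comp hA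
  have h2 : Tendsto (fun i => (A i).det) l (𝓝 B.det) :=
    ((continuous_id.matrix_det).tendsto B).comp hA
  have h3 := tendsto_matrix_inv hA hdet
  have h4 : Continuous fun q : Matrix (Fin p) (Fin p) ℝ × (Fin p → ℝ) => q.2 ⬝ᵥ (q.1 *ᵥ q.2) :=
    continuous_snd.dotProduct (continuous_fst.matrix_mulVec continuous_snd)
  have h5 := (h1.inv₀ htop).mul ((h4.tendsto (B⁻¹, y)).comp (h3.prodMk_nhds hy))
  refine h5.congr' ?_
  filter_upwards [h1.eventually_ne htop, h2.eventually_ne hdet] with i hi1 hi2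
  exact (andersonStat_eq (hsymm i) hi2 hi1 (s i)).symm

/-- The diagonal matrix with first entry `d` and all other entries equal to one. -/
def spikeDiag (d : ℝ) : Matrix (Fin p) (Fin p) ℝ :=
  Matrix.diagonal (Function.update (fun _ => 1) 0 d)

theorem continuous_spikeDiag : Continuous (spikeDiag (p := p)) := by
  unfold spikeDiag
  exact ((continuous_const.update 0 continuous_id)).matrix_diagonal

/-- The covariance matrix with a spike `ρ` transformed from the scatter matrix `1 + t / s`. -/
def spikedScatter (s ρ : ℝ) (t : Matrix (Fin p) (Fin p) ℝ) : Matrix (Fin p) (Fin p) ℝ :=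
  spikeDiag √(1 + ρ) * (1 + s⁻¹ • t) * spikeDiag √(1 + ρ)

theorem spikedScatter_apply (s ρ : ℝ) (t : Matrix (Fin p) (Fin p) ℝ) (i j : Fin p) :
    spikedScatter s ρ t i j = Function.update (fun _ => (1 : ℝ)) 0 √(1 + ρ) i *
      ((1 : Matrix (Fin p) (Fin p) ℝ) i j + s⁻¹ * t i j) *
      Function.update (fun _ => (1 : ℝ)) 0 √(1 + ρ) j := by
  simp [spikedScatter, spikeDiag]

theorem isSymm_spikedScatter (s ρ : ℝ) {t : Matrix (Fin p) (Fin p) ℝ} (ht : t.IsSymm) :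
    (spikedScatter s ρ t).IsSymm := by
  simp [IsSymm, spikedScatter, spikeDiag, transpose_mul, ht.eq, Matrix.mul_assoc]

theorem tendsto_spikedScatter {ι : Type*} {l : Filter ι} {s ρ : ι → ℝ}
    {t : ι → Matrix (Fin p) (Fin p) ℝ} {t₀ : Matrix (Fin p) (Fin p) ℝ} {ρ₀ : ℝ}
    (hs : Tendsto s l atTop) (hρ : Tendsto ρ l (𝓝 ρ₀)) (ht : Tendsto t l (𝓝 t₀)) :
    Tendsto (fun i => spikedScatter (s i) (ρ i) (t i)) l
      (𝓝 (spikeDiag √(1 + ρ₀) * spikeDiag √(1 + ρ₀))) := by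
  have h1 : Tendsto (fun i => spikeDiag (p := p) √(1 + ρ i)) l (𝓝 (spikeDiag √(1 + ρ₀))) :=
    (continuous_spikeDiag.tendsto _).comp ((Real.continuous_sqrt.tendsto _).comp (hρ.const_add 1))
  have h2 : Tendsto (fun i => 1 + (s i)⁻¹ • t i) l (𝓝 (1 + (0 : ℝ) • t₀)) :=
    ((tendsto_inv_atTop_zero.comp hs).smul ht).const_add 1
  have := (h1.mul h2).mul h1
  simpa [spikedScatter] using this

/-- Under contiguity, the Anderson statistic converges to `limitStat`. -/
theorem tendsto_andersonStat_of_contiguous {ι : Type*} {l : Filter ι} {s ρ : ι → ℝ}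
    {t : ι → Matrix (Fin p) (Fin p) ℝ} {t₀ : Matrix (Fin p) (Fin p) ℝ} {κ : ℝ}
    (hs : Tendsto s l atTop) (hρ : Tendsto (fun i => s i * ρ i) l (𝓝 κ))
    (ht : Tendsto t l (𝓝 t₀)) (hsymm : ∀ i, (t i).IsSymm) :
    Tendsto (fun i => andersonStat (s i ^ 2) (spikedScatter (s i) (ρ i) (t i))) l
      (𝓝 (limitStat (spiked t₀ κ))) := by
  have hs0 : ∀ᶠ i in l, 0 < s i := hs.eventually_gt_atTop 0
  have hinv : Tendsto (fun i => (s i)⁻¹) l (𝓝 0) := tendsto_inv_atTop_zero.comp hs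
  have hρ0 : Tendsto ρ l (𝓝 0) := by
    have := hinv.mul hρ
    rw [zero_mul] at this
    refine this.congr' ?_
    filter_upwards [hs0] with i hi
    field_simp
  have hA := tendsto_spikedScatter hs hρ0 ht
  have hone : spikeDiag (p := p) √(1 + 0) = 1 := by
    simp [spikeDiag, ← diagonal_one]
  rw [hone, one_mul] at hA
  have htop1 : topEig (1 : Matrix (Fin p) (Fin p) ℝ) = 1 := by
    simpa using topEig_one_add_smul (0 : Matrix (Fin p) (Fin p) ℝ) le_rfl
  have hW : Tendsto (fun i => s i • (spikedScatter (s i) (ρ i) (t i) - 1)) l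
      (𝓝 (spiked t₀ κ)) := by
    have hd : Tendsto (fun i => √(1 + ρ i)) l (𝓝 1) := by
      simpa [Function.comp_def] using (Real.continuous_sqrt.tendsto _).comp (hρ0.const_add 1)
    have hu : ∀ a : Fin p, Tendsto (fun i => Function.update (fun _ => (1 : ℝ)) 0 √(1 + ρ i) a) l
        (𝓝 1) := by
      intro a
      by_cases ha : a = 0
      · subst ha; simpa using hd
      · simpa [ha] using tendsto_const_nhds
    refine tendsto_pi_nhds.mpr fun a => tendsto_pi_nhds.mpr fun b => ?_
    have htab : Tendsto (fun i => t i a b) l (𝓝 (t₀ a b)) :=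
      (tendsto_pi_nhds.mp (tendsto_pi_nhds.mp ht a) b)
    have h1 : Tendsto (fun i => s i * (Function.update (fun _ => (1 : ℝ)) 0 √(1 + ρ i) a *
        (1 : Matrix (Fin p) (Fin p) ℝ) a b * Function.update (fun _ => (1 : ℝ)) 0 √(1 + ρ i) b -
        (1 : Matrix (Fin p) (Fin p) ℝ) a b)) l
        (𝓝 (Matrix.diagonal (Pi.single (0 : Fin p) κ) a b)) := by
      by_cases hab : a = b
      · subst hab
        by_cases ha : a = 0
        · subst ha
          simp only [Function.update_self, one_apply_eq, mul_one, diagonal_apply_eq,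
            Pi.single_eq_same]
          refine hρ.congr' ?_
          -- The sign of `ρ` is not prescribed here; `ρ > -1` eventually is enough for the square
          -- root to square back to `1 + ρ`.
          filter_upwards [hρ0.eventually (lt_mem_nhds (show (-1 : ℝ) < 0 by norm_num))] with i hi
          rw [Real.mul_self_sqrt (by linarith)]; ring
        · simpa [ha] using tendsto_const_nhds
      · simpa [hab] using tendsto_const_nhds
    have h2 := (((hu a).mul htab).mul (hu b)).add h1
    rw [one_mul, mul_one] at h2
    refine h2.congr' ?_
    filter_upwards [hs0] with i hi
    rw [Matrix.smul_apply, Matrix.sub_apply, spikedScatter_apply, smul_eq_mul]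
    field_simp
    ring
  have hres : Tendsto (fun i => s i • residual (spikedScatter (s i) (ρ i) (t i))) l
      (𝓝 (residual (spiked t₀ κ))) := by
    have hc : Continuous (residual (p := p)) := by
      have := continuous_topEig (p := p)
      unfold residual
      exact ((this.smul continuous_const).sub continuous_id).matrix_mulVec continuous_const
    refine ((hc.tendsto _).comp hW).congr' ?_
    filter_upwards [hs0] with i hi
    set S := spikedScatter (s i) (ρ i) (t i)
    -- With `W = s (S - 1)`, the affine rule for `topEig` turns `s` times the residual of `S` into
    -- exactly the residual of `W`.
    have hS : S = 1 + (s i)⁻¹ • (s i • (S - 1)) := by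
      rw [smul_smul, inv_mul_cancel₀ hi.ne', one_smul]; abel
    have htop : s i * (topEig S - 1) = topEig (s i • (S - 1)) := by
      conv_lhs => rw [hS, topEig_one_add_smul _ (inv_nonneg.mpr hi.le)]
      field_simp
      ring
    simp only [Function.comp, residual]
    rw [← htop, ← smul_mulVec]
    congr 1
    module
  have := tendsto_andersonStat (fun i => isSymm_spikedScatter (s i) (ρ i) (hsymm i)) hA
    (by simp) (by simp [htop1]) hres
  rw [htop1, inv_one, one_mul, inv_one, one_mulVec] at this
  convert this using 2
  rw [dotProduct, ← Finset.add_sum_erase _ _ (Finset.mem_univ 0), residual_zero, limitStat, sq]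
  congr 1
  refine Finset.sum_congr rfl fun j hj => ?_
  rw [residual_of_ne (Finset.ne_of_mem_erase hj)]; ring

/-- The top eigenvalue of a spiked scatter matrix exceeds its first diagonal entry by at most a
quantity of second order. -/
theorem topEig_spikedScatter_le {s ρ : ℝ} (hs : 0 < s) (hρ : 0 < ρ)
    {t : Matrix (Fin p) (Fin p) ℝ} (ht : t.IsSymm)
    (hgap : 0 ≤ s * ρ / 2 + ((1 + ρ) * t 0 0 - topEig t)) :
    topEig (spikedScatter s ρ t) ≤ spikedScatter s ρ t 0 0 +
      2 * (1 + ρ) * s⁻¹ ^ 2 * ‖WithLp.toLp 2 (t *ᵥ Pi.single 0 1)‖ ^ 2 / ρ := by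
  set A := spikedScatter s ρ t with hA
  set e : Fin p → ℝ := Pi.single 0 1 with he
  set D : Matrix (Fin p) (Fin p) ℝ := spikeDiag √(1 + ρ) with hD
  set d := √(1 + ρ) with hd
  have hd2 : d ^ 2 = 1 + ρ := Real.sq_sqrt (by linarith)
  set τ := ‖WithLp.toLp 2 (t *ᵥ e)‖ with hτ
  have hDT : Dᵀ = D := by simp [hD, spikeDiag]
  have hbil : ∀ x y : Fin p → ℝ, x ⬝ᵥ (A *ᵥ y) =
      (D *ᵥ x) ⬝ᵥ (D *ᵥ y) + s⁻¹ * ((D *ᵥ x) ⬝ᵥ (t *ᵥ (D *ᵥ y))) := by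
    intro x y
    rw [hA, spikedScatter, ← mulVec_mulVec, ← mulVec_mulVec, dotProduct_mulVec, ← mulVec_transpose,
      hDT, add_mulVec, one_mulVec, dotProduct_add, smul_mulVec, dotProduct_smul, smul_eq_mul]
  have hDe : D *ᵥ e = d • e := by
    ext j
    by_cases hj : j = 0
    · subst hj; simp [hD, spikeDiag, he, mulVec_diagonal]
    · simp [hD, spikeDiag, he, mulVec_diagonal, hj]
  have hDy : ∀ y : Fin p → ℝ, y 0 = 0 → D *ᵥ y = y := by
    intro y hy
    ext j
    by_cases hj : j = 0
    · subst hj; simp [hD, spikeDiag, mulVec_diagonal, hy]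
    · simp [hD, spikeDiag, mulVec_diagonal, hj]
  have hA00 : A 0 0 = (1 + ρ) * (1 + s⁻¹ * t 0 0) := by
    rw [hA, spikedScatter_apply]
    simp only [Function.update_self, one_apply_eq]
    linear_combination (1 + s⁻¹ * t 0 0) * hd2
  refine topEig_le fun x hx => ?_
  -- The unit vector splits along `e` and its complement, where `D` acts as the identity; the three
  -- resulting terms are bounded separately.
  set y : Fin p → ℝ := x.ofLp - x 0 • e with hy
  have hy0 : y 0 = 0 := by simp [hy, he]
  have hxy : x.ofLp = x 0 • e + y := by simp [hy]
  have hye : y ⬝ᵥ e = 0 := by simp [he, hy0]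
  have hee : e ⬝ᵥ e = 1 := by simp [he]
  have hnorm : x 0 ^ 2 + y ⬝ᵥ y = 1 := by
    have : x.ofLp ⬝ᵥ x.ofLp = 1 := by
      rw [← inner_eq_dotProduct, real_inner_self_eq_norm_sq, hx]; norm_num
    rw [hxy, add_dotProduct, dotProduct_add, dotProduct_add, smul_dotProduct, dotProduct_smul,
      smul_dotProduct, dotProduct_smul, hee, hye, dotProduct_comm e y, hye] at this
    simp only [smul_eq_mul] at this
    linarith
  have hAs : ∀ u w : Fin p → ℝ, u ⬝ᵥ (A *ᵥ w) = w ⬝ᵥ (A *ᵥ u) := by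
    intro u w
    rw [dotProduct_mulVec, ← mulVec_transpose, (isSymm_spikedScatter s ρ ht).eq, dotProduct_comm]
  have heAe : e ⬝ᵥ (A *ᵥ e) = A 0 0 := by simp [he]
  have hyAe : y ⬝ᵥ (A *ᵥ e) = d * s⁻¹ * (y ⬝ᵥ (t *ᵥ e)) := by
    rw [hbil, hDy y hy0, hDe, mulVec_smul, dotProduct_smul, dotProduct_smul, hye]
    simp only [smul_eq_mul]; ring
  have hyAy : y ⬝ᵥ (A *ᵥ y) = y ⬝ᵥ y + s⁻¹ * (y ⬝ᵥ (t *ᵥ y)) := by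
    rw [hbil, hDy y hy0]
  have hquad : x.ofLp ⬝ᵥ (A *ᵥ x.ofLp) = x 0 ^ 2 * A 0 0 +
      2 * x 0 * (d * s⁻¹ * (y ⬝ᵥ (t *ᵥ e))) + (y ⬝ᵥ y + s⁻¹ * (y ⬝ᵥ (t *ᵥ y))) := by
    conv_lhs => rw [hxy]
    rw [mulVec_add, add_dotProduct, dotProduct_add, dotProduct_add, mulVec_smul, smul_dotProduct,
      dotProduct_smul, smul_dotProduct, dotProduct_smul, heAe, hAs e y, hyAe, hyAy]
    simp only [smul_eq_mul]; ring
  set b := ‖WithLp.toLp 2 y‖ with hb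
  have hyy : y ⬝ᵥ y = b ^ 2 := by
    rw [hb, ← real_inner_self_eq_norm_sq, inner_eq_dotProduct]
  have hcs : |y ⬝ᵥ (t *ᵥ e)| ≤ b * τ := by
    have := abs_real_inner_le_norm (WithLp.toLp 2 y) (WithLp.toLp 2 (t *ᵥ e))
    rwa [inner_eq_dotProduct] at this
  have hyty := quadForm_le_topEig t y
  have hsinv : 0 < s⁻¹ := inv_pos.mpr hs
  have hd0 : 0 < d := Real.sqrt_pos.mpr (by linarith)
  set k := d * s⁻¹ * τ with hk
  have hδ : 2 * (1 + ρ) * s⁻¹ ^ 2 * τ ^ 2 / ρ = 2 * k ^ 2 / ρ := by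
    rw [hk, mul_pow, mul_pow, hd2]; ring
  have hcross : 2 * x 0 * (d * s⁻¹ * (y ⬝ᵥ (t *ᵥ e))) ≤ 2 * |x 0| * b * k := by
    calc 2 * x 0 * (d * s⁻¹ * (y ⬝ᵥ (t *ᵥ e))) ≤ |2 * x 0 * (d * s⁻¹ * (y ⬝ᵥ (t *ᵥ e)))| :=
          le_abs_self _
      _ = 2 * |x 0| * (d * s⁻¹) * |y ⬝ᵥ (t *ᵥ e)| := by
          rw [abs_mul, abs_mul, abs_mul (d * s⁻¹), abs_of_pos (mul_pos hd0 hsinv)]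
          norm_num; ring
      _ ≤ 2 * |x 0| * (d * s⁻¹) * (b * τ) := by gcongr
      _ = _ := by rw [hk]; ring
  -- Weighted AM-GM. The weight is chosen so that the `y` part costs `ρ / 2`, half of the gap; the
  -- other half absorbs the fluctuations of `t` in `hgap'`.
  have ham : 2 * |x 0| * b * k ≤ 2 * k ^ 2 / ρ * x 0 ^ 2 + ρ / 2 * b ^ 2 := by
    have h0 := sq_nonneg (2 * k * |x 0| - ρ * b)
    have : 2 * k ^ 2 / ρ * x 0 ^ 2 + ρ / 2 * b ^ 2 - 2 * |x 0| * b * k =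
        (2 * k * |x 0| - ρ * b) ^ 2 / (2 * ρ) := by
      rw [← sq_abs (x 0)]
      field_simp
      ring
    have h3 : 0 ≤ (2 * k * |x 0| - ρ * b) ^ 2 / (2 * ρ) := by positivity
    linarith
  have hgap' : ρ / 2 + 1 + s⁻¹ * topEig t ≤ A 0 0 := by
    rw [hA00]
    have := mul_nonneg hsinv.le hgap
    have h4 : s⁻¹ * (s * ρ / 2 + ((1 + ρ) * t 0 0 - topEig t)) =
      ρ / 2 + s⁻¹ * ((1 + ρ) * t 0 0 - topEig t) := by field_simp
    rw [h4] at this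
    linarith
  have hδ0 : 0 ≤ 2 * k ^ 2 / ρ := by positivity
  rw [hquad, hδ]
  have h5 : s⁻¹ * (y ⬝ᵥ (t *ᵥ y)) ≤ s⁻¹ * topEig t * b ^ 2 := by
    rw [mul_assoc, ← hyy]; gcongr
  have hx1 : x 0 ^ 2 = 1 - b ^ 2 := by rw [← hyy]; linarith
  rw [hyy]
  have h6 := mul_le_mul_of_nonneg_right hgap' (sq_nonneg b)
  have h7 : 0 ≤ 2 * k ^ 2 / ρ * b ^ 2 := by positivity
  rw [hx1] at ham ⊢
  nlinarith

/-- Away from contiguity, the Anderson statistic converges to the squared norm of the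
off-diagonal part of the first column. -/
theorem tendsto_andersonStat_of_spike {ι : Type*} {l : Filter ι} [l.NeBot] {s ρ : ι → ℝ}
    {t : ι → Matrix (Fin p) (Fin p) ℝ} {t₀ : Matrix (Fin p) (Fin p) ℝ} {ρ₀ : ℝ}
    (hs : Tendsto s l atTop) (hρ : Tendsto ρ l (𝓝 ρ₀))
    (hsρ : Tendsto (fun i => s i * ρ i) l atTop)
    (ht : Tendsto t l (𝓝 t₀)) (hsymm : ∀ i, (t i).IsSymm) :
    Tendsto (fun i => andersonStat (s i ^ 2) (spikedScatter (s i) (ρ i) (t i))) l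
      (𝓝 (∑ j ∈ Finset.univ.erase 0, t₀ j 0 ^ 2)) := by
  have hs0 : ∀ᶠ i in l, 0 < s i := hs.eventually_gt_atTop 0
  have hρ0 : ∀ᶠ i in l, 0 < ρ i := by
    filter_upwards [hs0, hsρ.eventually_gt_atTop 0] with i h1 h2
    exact pos_of_mul_pos_right h2 h1.le
  have hρ₀ : 0 ≤ ρ₀ := ge_of_tendsto hρ (hρ0.mono fun i hi => hi.le)
  have hA := tendsto_spikedScatter hs hρ ht
  set B : Matrix (Fin p) (Fin p) ℝ := spikeDiag √(1 + ρ₀) * spikeDiag √(1 + ρ₀) with hB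
  have hBd : B = Matrix.diagonal (Function.update (fun _ => 1) 0 (1 + ρ₀)) := by
    rw [hB, spikeDiag, diagonal_mul_diagonal]
    congr 1
    ext j
    by_cases hj : j = 0
    · subst hj; simp [Real.mul_self_sqrt (show 0 ≤ 1 + ρ₀ by linarith)]
    · simp [hj]
  have hB00 : B 0 0 = 1 + ρ₀ := by simp [hBd]
  have hentry : ∀ a b, Tendsto (fun i => t i a b) l (𝓝 (t₀ a b)) := fun a b =>
    tendsto_pi_nhds.mp (tendsto_pi_nhds.mp ht a) b
  have hτ : Tendsto (fun i => ‖WithLp.toLp 2 (t i *ᵥ Pi.single 0 1)‖) l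
      (𝓝 ‖WithLp.toLp 2 (t₀ *ᵥ Pi.single 0 1)‖) := by
    have hc : Continuous fun A : Matrix (Fin p) (Fin p) ℝ =>
        ‖WithLp.toLp 2 (A *ᵥ Pi.single 0 1)‖ :=
      ((PiLp.continuous_toLp 2 _).comp (continuous_id.matrix_mulVec continuous_const)).norm
    exact (hc.tendsto _).comp ht
  have htopt : Tendsto (fun i => topEig (t i)) l (𝓝 (topEig t₀)) :=
    (continuous_topEig.tendsto _).comp ht
  have hgap : ∀ᶠ i in l, 0 ≤ s i * ρ i / 2 + ((1 + ρ i) * t i 0 0 - topEig (t i)) :=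
    ((hsρ.atTop_div_const two_pos).atTop_add
      (((hρ.const_add 1).mul (hentry 0 0)).sub htopt)).eventually_ge_atTop 0
  -- The excess of order `1 / (s² ρ)`, multiplied by `s`, is of order `1 / (s ρ)`, which tends to
  -- zero as `s ρ → ∞`.
  have hfirst : Tendsto (fun i => s i * (topEig (spikedScatter (s i) (ρ i) (t i)) -
      spikedScatter (s i) (ρ i) (t i) 0 0)) l (𝓝 0) := by
    have hup : Tendsto (fun i => 2 * (1 + ρ i) * ‖WithLp.toLp 2 (t i *ᵥ Pi.single 0 1)‖ ^ 2 *
        (s i * ρ i)⁻¹) l (𝓝 0) := by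
      have := (((hρ.const_add 1).const_mul 2).mul (hτ.pow 2)).mul (tendsto_inv_atTop_zero.comp hsρ)
      simpa using this
    refine tendsto_of_tendsto_of_tendsto_of_le_of_le' tendsto_const_nhds hup ?_ ?_
    · filter_upwards [hs0] with i hi
      exact mul_nonneg hi.le (sub_nonneg.mpr (apply_zero_zero_le_topEig _))
    · filter_upwards [hs0, hρ0, hgap] with i h1 h2 h3
      have h4 := sub_le_iff_le_add'.mpr (topEig_spikedScatter_le h1 h2 (hsymm i) h3)
      calc _ ≤ s i * (2 * (1 + ρ i) * (s i)⁻¹ ^ 2 *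
            ‖WithLp.toLp 2 (t i *ᵥ Pi.single 0 1)‖ ^ 2 / ρ i) := by gcongr
        _ = _ := by field_simp
  -- The top eigenvalue of `B` is obtained by uniqueness of limits from `hfirst`, instead of
  -- diagonalizing `B`.
  have htopB : topEig B = 1 + ρ₀ := by
    have h1 : Tendsto (fun i => topEig (spikedScatter (s i) (ρ i) (t i)) -
        spikedScatter (s i) (ρ i) (t i) 0 0) l (𝓝 (topEig B - B 0 0)) :=
      ((continuous_topEig.tendsto _).comp hA).sub
        (tendsto_pi_nhds.mp (tendsto_pi_nhds.mp hA 0) 0)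
    have h2 := (tendsto_inv_atTop_zero.comp hs).mul hfirst
    rw [zero_mul] at h2
    have h3 := tendsto_nhds_unique h1 (h2.congr' (by
      filter_upwards [hs0] with i hi
      simp only [Function.comp]
      field_simp))
    rw [← hB00]; linarith
  have hres : Tendsto (fun i => s i • residual (spikedScatter (s i) (ρ i) (t i))) l
      (𝓝 (fun j => if j = 0 then 0 else - (√(1 + ρ₀) * t₀ j 0))) := by
    refine tendsto_pi_nhds.mpr fun j => ?_
    by_cases hj : j = 0
    · subst hj
      simpa [residual_zero] using hfirst
    · simp only [Pi.smul_apply, residual_of_ne hj, smul_eq_mul, if_neg hj]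
      have hd : Tendsto (fun i => √(1 + ρ i)) l (𝓝 √(1 + ρ₀)) :=
        (Real.continuous_sqrt.tendsto _).comp (hρ.const_add 1)
      refine ((hd.mul (hentry j 0)).neg).congr' ?_
      filter_upwards [hs0] with i hi
      rw [spikedScatter_apply]
      simp only [Function.update_of_ne hj, Function.update_self, one_apply_ne hj]
      field_simp
      ring
  have hdetB : B.det ≠ 0 := by
    rw [hBd, det_diagonal]
    refine Finset.prod_ne_zero_iff.mpr fun j _ => ?_
    by_cases hj : j = 0
    · subst hj; simp; linarith
    · simp [hj]
  have := tendsto_andersonStat (fun i => isSymm_spikedScatter (s i) (ρ i) (hsymm i)) hA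
    hdetB (by rw [htopB]; linarith) hres
  convert this using 2
  set y : Fin p → ℝ := fun j => if j = 0 then 0 else - (√(1 + ρ₀) * t₀ j 0) with hy
  -- `B` fixes vectors whose first coordinate is zero, hence so does `B⁻¹`. The factor `1 + ρ₀` left
  -- in `y ⬝ᵥ y` cancels against `(topEig B)⁻¹`.
  have hBy : B *ᵥ y = y := by
    ext j
    rw [hBd, mulVec_diagonal]
    by_cases hj : j = 0
    · subst hj; simp [hy]
    · simp [hj]
  have hBy' : B⁻¹ *ᵥ y = y := by
    conv_lhs => rw [← hBy]
    rw [mulVec_mulVec, nonsing_inv_mul B (isUnit_iff_ne_zero.mpr hdetB), one_mulVec]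
  rw [hBy', dotProduct, ← Finset.add_sum_erase _ _ (Finset.mem_univ 0), htopB]
  have h0 : y 0 * y 0 = 0 := by simp [hy]
  rw [h0, zero_add, Finset.mul_sum]
  refine Finset.sum_congr rfl fun j hj => ?_
  simp only [hy, if_neg (Finset.ne_of_mem_erase hj)]
  rw [neg_mul_neg, show √(1 + ρ₀) * t₀ j 0 * (√(1 + ρ₀) * t₀ j 0) =
    (√(1 + ρ₀) * √(1 + ρ₀)) * t₀ j 0 ^ 2 by ring,
    Real.mul_self_sqrt (show 0 ≤ 1 + ρ₀ by linarith)]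
  field_simp

end

/-! ### Extended continuous mapping theorem -/

/-- **Extended continuous mapping theorem**: if `X n` converges to `Z` in distribution and
`f n xₙ → h z` whenever `xₙ → z`, for almost all values `z` of `Z`, then `f n (X n)` converges
to `h Z` in distribution. -/
theorem tendstoInDistribution_comp_of_tendsto {E Ω' : Type*} {Ω : ℕ → Type*}
    {m : ∀ i, MeasurableSpace (Ω i)} {μ : (i : ℕ) → Measure (Ω i)}
    [∀ i, IsProbabilityMeasure (μ i)] {m' : MeasurableSpace Ω'} {μ' : Measure Ω'}
    [IsProbabilityMeasure μ'] {mE : MeasurableSpace E} [TopologicalSpace E]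
    [OpensMeasurableSpace E] [HasOuterApproxClosed E]
    {X : (i : ℕ) → Ω i → E} {Z : Ω' → E} (hX : TendstoInDistribution X atTop Z μ μ')
    {f : ℕ → E → ℝ} {h : E → ℝ} (hf : ∀ n, AEMeasurable (fun ω => f n (X n ω)) (μ n))
    (hh : AEMeasurable (fun ω => h (Z ω)) μ')
    (hlim : ∀ᵐ ω ∂μ', Tendsto (fun q : ℕ × E => f q.1 q.2) (atTop ×ˢ 𝓝 (Z ω)) (𝓝 (h (Z ω)))) :
    TendstoInDistribution (fun n ω => f n (X n ω)) atTop (fun ω => h (Z ω)) μ μ' where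
  forall_aemeasurable := hf
  aemeasurable_limit := hh
  tendsto := by
    refine tendsto_of_forall_isOpen_le_liminf_nat' fun G hG => ?_
    simp only [ProbabilityMeasure.coe_mk]
    rw [Measure.map_apply_of_aemeasurable hh hG.measurableSet]
    simp_rw [Measure.map_apply_of_aemeasurable (hf _) hG.measurableSet]
    -- Portmanteau needs an open set that does not move with `n`. For fixed `k`, membership in `U k`
    -- forces `f n x ∈ G` for every `n ≥ k`. The convergence hypothesis says that almost every value
    -- of `Z` with `h Z ∈ G` lies in some `U k`, and these sets increase.
    set U : ℕ → Set E := fun k => interior {x | ∀ n, k ≤ n → f n x ∈ G} with hU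
    have hUmono : Monotone U := fun a b hab =>
      interior_mono fun x hx n hn => hx n (hab.trans hn)
    have hsub : ∀ᵐ ω ∂μ', ω ∈ (fun ω => h (Z ω)) ⁻¹' G → ω ∈ ⋃ k, Z ⁻¹' U k := by
      filter_upwards [hlim] with ω hω hωG
      have h1 := hω (hG.mem_nhds hωG)
      rw [mem_map, mem_prod_iff] at h1
      obtain ⟨s, hs, t, ht, hst⟩ := h1
      obtain ⟨k, hk⟩ := mem_atTop_sets.mp hs
      refine Set.mem_iUnion.mpr ⟨k, mem_interior_iff_mem_nhds.mpr ?_⟩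
      filter_upwards [ht] with x hx n hn
      exact hst (Set.mk_mem_prod (hk n hn) hx)
    have hle : μ' ((fun ω => h (Z ω)) ⁻¹' G) ≤ μ' (⋃ k, Z ⁻¹' U k) := measure_mono_ae hsub
    refine hle.trans ?_
    have hmono : Monotone fun k => Z ⁻¹' U k := fun a b hab => Set.preimage_mono (hUmono hab)
    rw [hmono.measure_iUnion]
    refine iSup_le fun k => ?_
    have h2 := ProbabilityMeasure.le_liminf_measure_open_of_tendsto hX.tendsto
      (isOpen_interior (s := {x | ∀ n, k ≤ n → f n x ∈ G}))
    simp only [ProbabilityMeasure.coe_mk] at h2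
    rw [Measure.map_apply_of_aemeasurable hX.aemeasurable_limit isOpen_interior.measurableSet] at h2
    refine h2.trans ?_
    refine liminf_le_liminf ?_
    filter_upwards [eventually_ge_atTop k] with n hn
    rw [Measure.map_apply_of_aemeasurable (hX.forall_aemeasurable n) isOpen_interior.measurableSet]
    exact measure_mono fun ω hω => interior_subset hω n hn

/-! ### Gaussian measures and null sets -/

theorem pi_absolutelyContinuous_fin {α : Type*} [MeasurableSpace α] {μ ν : Measure α}
    [SigmaFinite μ] [SigmaFinite ν] (h : μ ≪ ν) (n : ℕ) :
    Measure.pi (fun _ : Fin n => μ) ≪ Measure.pi (fun _ : Fin n => ν) := by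
  induction n with
  | zero => rw [Measure.pi_of_empty, Measure.pi_of_empty]
  | succ n ih =>
    have h1 := (measurePreserving_piFinSuccAbove (fun _ : Fin (n + 1) => μ) 0).symm
    have h2 := (measurePreserving_piFinSuccAbove (fun _ : Fin (n + 1) => ν) 0).symm
    rw [← h1.map_eq, ← h2.map_eq]
    exact (h.prod ih).map h1.measurable

/-- A finite power of an absolutely continuous measure is absolutely continuous. -/
theorem pi_absolutelyContinuous {ι α : Type*} [Fintype ι] [MeasurableSpace α] {μ ν : Measure α}
    [SigmaFinite μ] [SigmaFinite ν] (h : μ ≪ ν) :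
    Measure.pi (fun _ : ι => μ) ≪ Measure.pi (fun _ : ι => ν) := by
  have e := (Fintype.equivFin ι).symm
  have h1 := measurePreserving_piCongrLeft (fun _ : ι => μ) e
  have h2 := measurePreserving_piCongrLeft (fun _ : ι => ν) e
  rw [← h1.map_eq, ← h2.map_eq]
  exact (pi_absolutelyContinuous_fin h _).map h1.measurable

theorem stdGaussian_absolutelyContinuous {ι : Type*} [Fintype ι] :
    stdGaussian (EuclideanSpace ℝ ι) ≪ volume := by
  rw [← map_pi_eq_stdGaussian, ← (PiLp.volume_preserving_toLp ι).map_eq]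
  exact (pi_absolutelyContinuous (gaussianReal_absolutelyContinuous 0 one_ne_zero)).map
    (PiLp.volume_preserving_toLp ι).measurable

instance isOpenPosMeasure_stdGaussian {ι : Type*} [Fintype ι] :
    (stdGaussian (EuclideanSpace ℝ ι)).IsOpenPosMeasure := by
  have : (gaussianReal 0 1).IsOpenPosMeasure :=
    (gaussianReal_absolutelyContinuous' 0 one_ne_zero).isOpenPosMeasure
  rw [← map_pi_eq_stdGaussian]
  exact (PiLp.continuous_toLp 2 _).isOpenPosMeasure_map (WithLp.toLp_surjective 2)

/-- A measurable set meeting almost every point of each ray from a fixed point in a null set is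
null. -/
theorem volume_eq_zero_of_rays {E : Type*} [NormedAddCommGroup E] [NormedSpace ℝ E]
    [FiniteDimensional ℝ E] [MeasurableSpace E] [BorelSpace E] (μ : Measure E)
    [μ.IsAddHaarMeasure] {N : Set E} (hN : MeasurableSet N) (a : E)
    (h : ∀ x, {s : ℝ | a + s • x ∈ N}.Countable) : μ N = 0 := by
  set g : ℝ × E → E := fun q => a + q.1 • q.2 with hg
  have hgm : Measurable g := by fun_prop
  -- Fubini: for each direction `x` the bad parameters `s` are countable, hence null, so for almost
  -- every `s` the bad directions are null. One such `s ≠ 0` suffices, as translation and dilation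
  -- preserve null sets.
  have h1 : ((volume : Measure ℝ).prod μ) (g ⁻¹' N) = 0 := by
    rw [Measure.prod_apply_symm (hgm hN)]
    exact (lintegral_congr fun x => (h x).measure_zero volume).trans lintegral_zero
  have h2 := (Measure.measure_prod_null (hgm hN)).mp h1
  obtain ⟨s, hs, hs0⟩ : ∃ s : ℝ, μ (Prod.mk s ⁻¹' (g ⁻¹' N)) = 0 ∧ s ≠ 0 := by
    have h3 : ∀ᵐ s : ℝ, s ≠ 0 := by
      simp [ae_iff]
    exact (h2.and h3).exists
  have h4 : Prod.mk s ⁻¹' (g ⁻¹' N) = (fun x => s • x) ⁻¹' ((fun x => a + x) ⁻¹' N) := rfl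
  rw [h4, Measure.addHaar_preimage_smul μ hs0, measure_preimage_add] at hs
  rcases mul_eq_zero.mp hs with h5 | h5
  · exfalso
    simp [hs0] at h5
  · exact h5

open scoped Polynomial in
/-- Along a line through a matrix with simple spectrum, only finitely many matrices have a
vanishing discriminant. -/
theorem finite_det_powerTraces_eq_zero {p : ℕ} {A : Matrix (Fin p) (Fin p) ℝ}
    (hA : (powerTraces A).det ≠ 0) (B : Matrix (Fin p) (Fin p) ℝ) :
    {s : ℝ | (powerTraces (A + s • B)).det = 0}.Finite := by
  set M : Matrix (Fin p) (Fin p) ℝ[X] :=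
    A.map Polynomial.C + (Polynomial.X : ℝ[X]) • B.map Polynomial.C with hM
  -- The discriminant along the line is a polynomial in `s`. It is nonzero because its value at `s =
  -- 0` is, so it has finitely many roots.
  have heval : ∀ s : ℝ, (powerTraces M).det.eval s = (powerTraces (A + s • B)).det := by
    intro s
    have h1 : A + s • B = M.map (Polynomial.evalRingHom s) := by
      ext i j
      simp only [hM, map_apply, Matrix.add_apply, Matrix.smul_apply, smul_eq_mul,
        Polynomial.coe_evalRingHom, Polynomial.eval_add, Polynomial.eval_mul, Polynomial.eval_C,
        Polynomial.eval_X]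
    rw [h1, powerTraces_map, ← RingHom.mapMatrix_apply, ← RingHom.map_det]
    rfl
  have hne : (powerTraces M).det ≠ 0 := by
    intro h
    apply hA
    have := heval 0
    rw [h, Polynomial.eval_zero, zero_smul, add_zero] at this
    exact this.symm
  refine (Polynomial.finite_setOfPred_isRoot hne).subset fun s hs => ?_
  rw [Set.mem_ofPred_eq, Polynomial.IsRoot.def, heval]
  exact hs

theorem det_powerTraces_diagonal_ne_zero {p : ℕ} {c : Fin p → ℝ} (hc : Function.Injective c) :
    (powerTraces (Matrix.diagonal c)).det ≠ 0 := by
  have : powerTraces (Matrix.diagonal c) = (vandermonde c)ᵀ * vandermonde c := by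
    ext i j
    rw [powerTraces, of_apply, diagonal_pow, trace_diagonal]
    simp [mul_apply, vandermonde_apply, pow_add]
  rw [this, det_mul, det_transpose]
  exact mul_self_ne_zero.mpr (det_vandermonde_ne_zero_iff.mpr hc)

/-! ### The chi-square distribution and its quantiles -/

theorem chiSquare_eq_map_stdGaussian (k : ℕ) :
    chiSquare k = (stdGaussian (EuclideanSpace ℝ (Fin k))).map fun x => ∑ i, x i ^ 2 := by
  rw [← map_pi_eq_stdGaussian, Measure.map_map (by fun_prop) (by fun_prop)]
  rfl

/-- Level sets of the squared norm lie in spheres, which are Lebesgue null. For `k = 0` the law is a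
point mass at zero, hence `k ≠ 0`. -/
theorem chiSquare_singleton {k : ℕ} (hk : k ≠ 0) (c : ℝ) : chiSquare k {c} = 0 := by
  have : Nonempty (Fin k) := ⟨⟨0, Nat.pos_of_ne_zero hk⟩⟩
  rw [chiSquare_eq_map_stdGaussian, Measure.map_apply (by fun_prop) (measurableSet_singleton c)]
  refine stdGaussian_absolutelyContinuous ?_
  refine measure_mono_null (t := Metric.sphere 0 √c) ?_ (Measure.addHaar_sphere _ _ _)
  intro x hx
  have hx' : ∑ i, x i ^ 2 = c := hx
  rw [mem_sphere_zero_iff_norm, EuclideanSpace.norm_eq]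
  simp [← hx']

instance nullSingletonClass_chiSquare {k : ℕ} [NeZero k] : NullSingletonClass (chiSquare k) :=
  ⟨fun c => chiSquare_singleton (NeZero.ne k) c⟩

theorem continuous_cdf (μ : Measure ℝ) [IsProbabilityMeasure μ] [NullSingletonClass μ] :
    Continuous (cdf μ) := by
  refine continuous_iff_continuousAt.mpr fun x => ?_
  rw [(monotone_cdf μ).continuousAt_iff_leftLim_eq_rightLim, (cdf μ).rightLim_eq]
  have h := (cdf μ).measure_singleton x
  rw [measure_cdf, measure_singleton] at h
  refine le_antisymm ((monotone_cdf μ).leftLim_le le_rfl) ?_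
  have := ENNReal.ofReal_eq_zero.mp h.symm
  linarith

/-- The infimum is attained because the distribution function is continuous. Points to its left have
values below `1 - α`, and continuity passes this bound to the infimum. -/
theorem cdf_chiSquareUpperQuantile {k : ℕ} [NeZero k] {α : ℝ} (hα : α ∈ Set.Ioo (0 : ℝ) 1) :
    cdf (chiSquare k) (chiSquareUpperQuantile k α) = 1 - α := by
  have hc := continuous_cdf (chiSquare k)
  obtain ⟨b, hb⟩ : ∃ b, 1 - α < cdf (chiSquare k) b :=
    ((tendsto_cdf_atTop (chiSquare k)).eventually (lt_mem_nhds (by linarith [hα.1]))).exists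
  obtain ⟨a, ha⟩ : ∃ a, cdf (chiSquare k) a < 1 - α :=
    ((tendsto_cdf_atBot (chiSquare k)).eventually (gt_mem_nhds (by linarith [hα.2]))).exists
  set S : Set ℝ := {x | 1 - α ≤ cdf (chiSquare k) x} with hS
  have hbdd : BddBelow S := by
    refine ⟨a, fun x hx => ?_⟩
    by_contra hlt
    exact absurd (hx.trans (monotone_cdf _ (not_le.mp hlt).le)) (not_le.mpr ha)
  have hmem : sInf S ∈ S :=
    (isClosed_le continuous_const hc).csInf_mem ⟨b, hb.le⟩ hbdd
  refine le_antisymm ?_ hmem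
  refine le_of_tendsto (hc.continuousWithinAt (s := Set.Iio (sInf S)) (x := sInf S)) ?_
  filter_upwards [self_mem_nhdsWithin] with x hx
  exact (not_le.mp fun h => absurd (csInf_le hbdd h) (not_le.mpr hx)).le

theorem chiSquare_Ioi_upperQuantile {k : ℕ} [NeZero k] {α : ℝ} (hα : α ∈ Set.Ioo (0 : ℝ) 1) :
    chiSquare k (Set.Ioi (chiSquareUpperQuantile k α)) = ENNReal.ofReal α := by
  have h := cdf_chiSquareUpperQuantile (k := k) hα
  rw [cdf_eq_real] at h
  have h2 := probReal_compl_eq_one_sub (μ := chiSquare k)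
    (measurableSet_Iic (a := chiSquareUpperQuantile k α))
  rw [h, Set.compl_Iic, sub_sub_cancel] at h2
  rw [← ofReal_measureReal (μ := chiSquare k), h2]

theorem chiSquareUpperQuantile_pos {k : ℕ} [NeZero k] {α : ℝ} (hα : α ∈ Set.Ioo (0 : ℝ) 1) :
    0 < chiSquareUpperQuantile k α := by
  by_contra hle
  have h := cdf_chiSquareUpperQuantile (k := k) hα
  have h0 : chiSquare k (Set.Iic 0) = 0 := by
    rw [← Set.Iio_insert, Set.insert_eq, measure_union_null_iff]
    refine ⟨measure_singleton 0, ?_⟩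
    rw [chiSquare, Measure.map_apply (by fun_prop) measurableSet_Iio]
    have : (fun x : Fin k → ℝ => ∑ i, x i ^ 2) ⁻¹' Set.Iio 0 = ∅ := by
      ext x
      simpa using Finset.sum_nonneg fun i _ => sq_nonneg (x i)
    rw [this, measure_empty]
  have h1 := monotone_cdf (chiSquare k) (not_lt.mp hle)
  rw [h, cdf_eq_real, measureReal_def, h0] at h1
  simp at h1
  linarith [hα.2]

/-! ### The symmetric Gaussian matrix -/

section

variable {p : ℕ}

/-- The inverse of vectorization. -/
def unvec (x : EuclideanSpace ℝ (Fin p × Fin p)) : Matrix (Fin p) (Fin p) ℝ :=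
  Matrix.of fun i j => x (j, i)

@[simp]
theorem unvec_apply (x : EuclideanSpace ℝ (Fin p × Fin p)) (i j : Fin p) :
    unvec x i j = x (j, i) := rfl

@[simp]
theorem unvec_toLp_vec (A : Matrix (Fin p) (Fin p) ℝ) : unvec (WithLp.toLp 2 A.vec) = A := rfl

theorem continuous_unvec : Continuous (unvec (p := p)) :=
  continuous_pi fun i => continuous_pi fun j => by
    simp only [unvec_apply]; fun_prop

/-- The permutation of the coordinates of a vectorized matrix induced by transposition. -/
def swapEquiv (p : ℕ) : EuclideanSpace ℝ (Fin p × Fin p) ≃ₗᵢ[ℝ] EuclideanSpace ℝ (Fin p × Fin p) :=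
  LinearIsometryEquiv.piLpCongrLeft 2 ℝ ℝ (Equiv.prodComm (Fin p) (Fin p))

@[simp]
theorem swapEquiv_apply (x : EuclideanSpace ℝ (Fin p × Fin p)) (a : Fin p × Fin p) :
    swapEquiv p x a = x a.swap := by
  simp [swapEquiv, LinearIsometryEquiv.piLpCongrLeft_apply, Equiv.piCongrLeft'_apply]

@[simp]
theorem swapEquiv_swapEquiv (x : EuclideanSpace ℝ (Fin p × Fin p)) :
    swapEquiv p (swapEquiv p x) = x := by
  ext a; simp

theorem inner_swapEquiv (x y : EuclideanSpace ℝ (Fin p × Fin p)) :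
    inner ℝ (swapEquiv p x) y = inner ℝ x (swapEquiv p y) := by
  conv_rhs => rw [← (swapEquiv p).inner_map_map, swapEquiv_swapEquiv]

/-- The map `(x + x') / √2`, which symmetrizes vectorized matrices. -/
def symmetrize (p : ℕ) :
    EuclideanSpace ℝ (Fin p × Fin p) →L[ℝ] EuclideanSpace ℝ (Fin p × Fin p) :=
  (√2)⁻¹ • (ContinuousLinearMap.id ℝ _ + (swapEquiv p : _ →L[ℝ] _))

theorem symmetrize_apply (x : EuclideanSpace ℝ (Fin p × Fin p)) :
    symmetrize p x = (√2)⁻¹ • (x + swapEquiv p x) := rfl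

theorem inner_symmetrize (x y : EuclideanSpace ℝ (Fin p × Fin p)) :
    inner ℝ (symmetrize p x) y = inner ℝ x (symmetrize p y) := by
  simp only [symmetrize_apply, inner_smul_left, inner_smul_right, inner_add_left, inner_add_right,
    inner_swapEquiv]
  simp

/-- The swap is an isometry, so the two square terms agree and the factor `1/√2` normalizes them.
The right side is the quadratic form of `I + K`, which makes `symmetrize` a square root of that
covariance. -/
theorem norm_symmetrize_sq (x : EuclideanSpace ℝ (Fin p × Fin p)) :
    ‖symmetrize p x‖ ^ 2 = ‖x‖ ^ 2 + inner ℝ x (swapEquiv p x) := by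
  rw [symmetrize_apply, norm_smul, mul_pow, @norm_add_sq_real, LinearIsometryEquiv.norm_map,
    norm_inv, inv_pow, Real.norm_eq_abs, sq_abs, Real.sq_sqrt two_pos.le]
  ring

theorem isSymm_unvec_symmetrize (x : EuclideanSpace ℝ (Fin p × Fin p)) :
    (unvec (symmetrize p x)).IsSymm := by
  ext i j
  simp [symmetrize_apply, add_comm]

theorem one_add_commutationMatrix_quadForm (x : EuclideanSpace ℝ (Fin p × Fin p)) :
    x.ofLp ⬝ᵥ ((1 + commutationMatrix p) *ᵥ x.ofLp) = ‖symmetrize p x‖ ^ 2 := by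
  have h : commutationMatrix p *ᵥ x.ofLp = (swapEquiv p x).ofLp := by
    have := commutationMatrix_mulVec_vec (unvec x)
    have h1 : (unvec x).vec = x.ofLp := rfl
    rw [h1] at this
    rw [this]
    ext a
    rw [swapEquiv_apply]
    rfl
  rw [norm_symmetrize_sq, add_mulVec, one_mulVec, dotProduct_add, h, ← inner_eq_dotProduct,
    ← inner_eq_dotProduct, real_inner_self_eq_norm_sq]

theorem posSemidef_one_add_commutationMatrix : (1 + commutationMatrix p).PosSemidef := by
  refine PosSemidef.of_dotProduct_mulVec_nonneg ?_ fun x => ?_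
  · ext a b
    simp [commutationMatrix, one_apply, eq_comm, Prod.ext_iff, and_comm]
  · have := one_add_commutationMatrix_quadForm (WithLp.toLp 2 x)
    simp only [star_trivial]
    rw [this]
    positivity

/-- The vector `u` is the adjoint of `L` applied to `t`; Gaussian images are then identified by
comparing norms. -/
theorem charFun_map_continuousLinearMap {E F : Type*} [NormedAddCommGroup E]
    [InnerProductSpace ℝ E] [MeasurableSpace E] [BorelSpace E] [NormedAddCommGroup F]
    [InnerProductSpace ℝ F] [MeasurableSpace F] [BorelSpace F] [SecondCountableTopology F]
    {μ : Measure E} (L : E →L[ℝ] F)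
    {t : F} {u : E} (h : ∀ x, inner ℝ (L x) t = inner ℝ x u) :
    charFun (μ.map L) t = charFun μ u := by
  rw [charFun_apply, charFun_apply, integral_map (by fun_prop) (by fun_prop)]
  simp_rw [h]

/-- The Gaussian law with covariance `I + K` is the law of a symmetrized standard Gaussian
matrix. -/
theorem multivariateGaussian_one_add_commutationMatrix :
    multivariateGaussian 0 (1 + commutationMatrix p) =
      (stdGaussian (EuclideanSpace ℝ (Fin p × Fin p))).map (symmetrize p) := by
  have : IsProbabilityMeasure
      ((stdGaussian (EuclideanSpace ℝ (Fin p × Fin p))).map (symmetrize p)) :=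
    Measure.isProbabilityMeasure_map (by fun_prop)
  apply Measure.ext_of_charFun
  ext t
  rw [charFun_map_continuousLinearMap _ (fun x => inner_symmetrize x t), charFun_stdGaussian,
    charFun_multivariateGaussian posSemidef_one_add_commutationMatrix]
  rw [one_add_commutationMatrix_quadForm]
  simp [neg_div]

theorem isHermitian_of_isSymm {A : Matrix (Fin p) (Fin p) ℝ} (hA : A.IsSymm) : A.IsHermitian := by
  rw [IsHermitian, conjTranspose_eq_transpose_of_trivial, hA.eq]

variable [NeZero p]

/-- The off-diagonal part of the first column of a symmetrized standard Gaussian matrix has a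
standard Gaussian law, so that its squared norm follows the chi-square distribution. -/
theorem map_sum_sq_first_column :
    (multivariateGaussian 0 (1 + commutationMatrix p)).map
      (fun x => ∑ j ∈ Finset.univ.erase 0, unvec x j 0 ^ 2) = chiSquare (p - 1) := by
  have hcard : (Finset.univ.erase (0 : Fin p)).card = p - 1 := by simp
  set σ := (Finset.equivFinOfCardEq hcard).symm with hσ
  have hσ0 : ∀ k, (σ k : Fin p) ≠ 0 := fun k => Finset.ne_of_mem_erase (σ k).2
  let L : EuclideanSpace ℝ (Fin p × Fin p) →L[ℝ] EuclideanSpace ℝ (Fin (p - 1)) :=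
    (PiLp.continuousLinearEquiv 2 ℝ _).symm.toContinuousLinearMap.comp
      (ContinuousLinearMap.pi fun k => EuclideanSpace.proj (0, (σ k : Fin p)))
  have hL : ∀ x k, L x k = x (0, (σ k : Fin p)) := fun x k => rfl
  have hsum : (fun x => ∑ j ∈ Finset.univ.erase 0, unvec x j 0 ^ 2) =
      (fun y : EuclideanSpace ℝ (Fin (p - 1)) => ∑ k, y k ^ 2) ∘ L := by
    ext x
    simp only [Function.comp, hL, unvec_apply]
    rw [← Finset.sum_coe_sort, ← σ.sum_comp]
  have hmap : (multivariateGaussian 0 (1 + commutationMatrix p)).map L =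
      stdGaussian (EuclideanSpace ℝ (Fin (p - 1))) := by
    have : IsProbabilityMeasure ((multivariateGaussian 0 (1 + commutationMatrix p)).map L) :=
      Measure.isProbabilityMeasure_map (by fun_prop)
    apply Measure.ext_of_charFun
    ext u
    set y : EuclideanSpace ℝ (Fin p × Fin p) :=
      ∑ k, u k • EuclideanSpace.single (0, (σ k : Fin p)) (1 : ℝ) with hy
    have hadj : ∀ x, inner ℝ (L x) u = inner ℝ x y := by
      intro x
      rw [hy, inner_sum, PiLp.inner_apply]
      refine Finset.sum_congr rfl fun k _ => ?_
      rw [inner_smul_right, EuclideanSpace.inner_single_right, hL]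
      simp
    have hy1 : L y = u := by
      ext k
      rw [hL, hy]
      simp [Finset.sum_apply, Pi.single_apply, Subtype.ext_iff.symm]
    -- Indices are (column, row). The transpose of `y` is supported at `(σ k, 0)` with `σ k ≠ 0`,
    -- away from the first column read by `L`. Hence the commutation term vanishes and the entries
    -- are uncorrelated with unit variance.
    have hy2 : L (swapEquiv p y) = 0 := by
      ext k
      rw [hL, hy]
      simp [hσ0]
    have hnorm : ‖symmetrize p y‖ ^ 2 = ‖u‖ ^ 2 := by
      rw [norm_symmetrize_sq, real_inner_comm, ← hadj, hy2, inner_zero_left, add_zero,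
        ← real_inner_self_eq_norm_sq, ← hadj, hy1, real_inner_self_eq_norm_sq]
    rw [charFun_map_continuousLinearMap L hadj, charFun_stdGaussian,
      charFun_multivariateGaussian posSemidef_one_add_commutationMatrix,
      one_add_commutationMatrix_quadForm, hnorm]
    simp [neg_div]
  rw [hsum, ← Measure.map_map (by fun_prop) (by fun_prop), hmap, chiSquare_eq_map_stdGaussian]

theorem continuous_spiked (v : ℝ) :
    Continuous fun x : EuclideanSpace ℝ (Fin p × Fin p) => spiked (unvec x) v := by
  have := continuous_unvec (p := p)
  unfold spiked
  fun_prop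

theorem isSymm_spiked {A : Matrix (Fin p) (Fin p) ℝ} (hA : A.IsSymm) (v : ℝ) :
    (spiked A v).IsSymm := by
  simp [IsSymm, spiked, hA.eq]

/-- The eigenvalues of a spiked Gaussian matrix are almost surely distinct. -/
theorem ae_det_powerTraces_ne_zero (v : ℝ) :
    ∀ᵐ x ∂multivariateGaussian 0 (1 + commutationMatrix p),
      (unvec x).IsSymm ∧ (powerTraces (spiked (unvec x) v)).det ≠ 0 := by
  have hcont : Continuous fun x : EuclideanSpace ℝ (Fin p × Fin p) =>
      (powerTraces (spiked (unvec x) v)).det := by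
    refine Continuous.matrix_det ?_
    refine continuous_pi fun i => continuous_pi fun j => ?_
    exact ((continuous_spiked v).pow _).matrix_trace
  have hsymm : MeasurableSet {x : EuclideanSpace ℝ (Fin p × Fin p) | (unvec x).IsSymm} :=
    (isClosed_eq continuous_unvec.matrix_transpose continuous_unvec).measurableSet
  have hne : MeasurableSet {x : EuclideanSpace ℝ (Fin p × Fin p) |
      (powerTraces (spiked (unvec x) v)).det ≠ 0} :=
    (isOpen_ne_fun hcont continuous_const).measurableSet
  rw [multivariateGaussian_one_add_commutationMatrix,
    ae_map_iff (p := fun x => (unvec x).IsSymm ∧ (powerTraces (spiked (unvec x) v)).det ≠ 0)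
      (by fun_prop) (hsymm.inter hne)]
  suffices h : ∀ᵐ x : EuclideanSpace ℝ (Fin p × Fin p),
      (powerTraces (spiked (unvec (symmetrize p x)) v)).det ≠ 0 by
    filter_upwards [stdGaussian_absolutelyContinuous.ae_le h] with x hx
    exact ⟨isSymm_unvec_symmetrize x, hx⟩
  set D : Matrix (Fin p) (Fin p) ℝ := Matrix.diagonal fun i => (i : ℕ) with hD
  -- The base point of the rays is chosen so that its spiked symmetrization is `D`, with distinct
  -- eigenvalues `0, …, p - 1`. The factor `1/√2` compensates for `symmetrize` multiplying symmetric
  -- matrices by `√2`.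
  set a : EuclideanSpace ℝ (Fin p × Fin p) :=
    WithLp.toLp 2 ((√2)⁻¹ • (D - Matrix.diagonal (Pi.single 0 v))).vec with ha
  have hline : ∀ x (s : ℝ), spiked (unvec (symmetrize p (a + s • x))) v =
      D + s • unvec (symmetrize p x) := by
    intro x s
    have hsa : unvec (symmetrize p a) = D - Matrix.diagonal (Pi.single 0 v) := by
      have h2 : (√2)⁻¹ * (√2)⁻¹ = (2 : ℝ)⁻¹ := by
        rw [← mul_inv, Real.mul_self_sqrt two_pos.le]
      ext i j
      have hDij : ∀ i j, D i j - Matrix.diagonal (Pi.single (0 : Fin p) v) i j =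
          D j i - Matrix.diagonal (Pi.single (0 : Fin p) v) j i := by
        intro i j
        by_cases hij : i = j
        · rw [hij]
        · simp [hD, hij, Ne.symm hij]
      have hsum : ∀ c : ℝ, (√2)⁻¹ * ((√2)⁻¹ * c + (√2)⁻¹ * c) = c := by
        intro c; linear_combination 2 * c * h2
      simp only [unvec_apply, symmetrize_apply, ha, PiLp.smul_apply, PiLp.add_apply,
        swapEquiv_apply, Matrix.vec, Matrix.smul_apply, Matrix.sub_apply, smul_eq_mul,
        Prod.swap_prod_mk]
      rw [hDij j i, hsum]
    rw [map_add, map_smul]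
    have h3 : unvec (symmetrize p a + s • symmetrize p x) =
        unvec (symmetrize p a) + s • unvec (symmetrize p x) := rfl
    rw [h3, hsa, spiked]
    abel
  rw [ae_iff]
  refine volume_eq_zero_of_rays _ ?_ a fun x => ?_
  · simp only [not_not]
    exact (isClosed_eq (hcont.comp (symmetrize p).continuous) continuous_const).measurableSet
  · simp only [Set.mem_ofPred_eq, not_not, hline]
    refine (finite_det_powerTraces_eq_zero (det_powerTraces_diagonal_ne_zero ?_) _).countable
    intro i j hij
    exact Fin.ext (Nat.cast_injective (R := ℝ) hij)

/-- The limiting law under contiguity puts more mass than the chi-square distribution above any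
positive level. -/
theorem chiSquare_Ioi_lt (hp : 2 ≤ p) {v c : ℝ} (hc : 0 < c) :
    chiSquare (p - 1) (Set.Ioi c) <
      (multivariateGaussian 0 (1 + commutationMatrix p))
        {x | c < limitStat (spiked (unvec x) v)} := by
  set μ := multivariateGaussian 0 (1 + commutationMatrix p) with hμ
  set χ : EuclideanSpace ℝ (Fin p × Fin p) → ℝ :=
    fun x => ∑ j ∈ Finset.univ.erase 0, unvec x j 0 ^ 2 with hχ
  have hχc : Continuous χ := by
    simp only [hχ, unvec_apply]
    fun_prop
  have hLc : Continuous fun x : EuclideanSpace ℝ (Fin p × Fin p) =>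
      limitStat (spiked (unvec x) v) := continuous_limitStat.comp (continuous_spiked v)
  have hL : ∀ x : EuclideanSpace ℝ (Fin p × Fin p), limitStat (spiked (unvec x) v) =
      (topEig (spiked (unvec x) v) - spiked (unvec x) v 0 0) ^ 2 + χ x := by
    intro x
    rw [limitStat]
    congr 1
    refine Finset.sum_congr rfl fun j hj => ?_
    simp [spiked, Finset.ne_of_mem_erase hj]
  have h1 : chiSquare (p - 1) (Set.Ioi c) = μ {x | c < χ x} := by
    rw [← map_sum_sq_first_column, Measure.map_apply hχc.measurable measurableSet_Ioi]
    rfl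
  -- Since `limitStat` is `χ` plus a square, one event contains the other. Strictness comes from
  -- this open set, on which only the larger variable exceeds `c`.
  set U : Set (EuclideanSpace ℝ (Fin p × Fin p)) :=
    {x | χ x < c} ∩ {x | c < limitStat (spiked (unvec x) v)} with hU
  have hUo : IsOpen U :=
    (isOpen_lt hχc continuous_const).inter (isOpen_lt continuous_const hLc)
  have hUpos : μ U ≠ 0 := by
    rw [hμ, multivariateGaussian_one_add_commutationMatrix,
      Measure.map_apply (by fun_prop) hUo.measurableSet]
    -- The law of the symmetric matrix is carried by a proper subspace, so positivity is checked on
    -- the full-support Gaussian before symmetrization.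
    refine (hUo.preimage (symmetrize p).continuous).measure_ne_zero _ ?_
    set k : Fin p := ⟨1, by omega⟩ with hk
    have hk0 : k ≠ 0 := by
      intro h
      have := congrArg Fin.val h
      simp [hk] at this
    -- A single diagonal entry `m` outside the first position, available as `p ≥ 2`, leaves `χ = 0`
    -- while the top eigenvalue is at least `m`, hence exceeds `v` by more than `√c`.
    set m : ℝ := √c + |v| + 1 with hm
    have h0 : 0 < √c := Real.sqrt_pos.mpr hc
    set x₀ : EuclideanSpace ℝ (Fin p × Fin p) :=
      EuclideanSpace.single (k, k) ((√2)⁻¹ * m) with hx₀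
    have hs : symmetrize p x₀ = EuclideanSpace.single (k, k) m := by
      have h2 : (√2)⁻¹ * (√2)⁻¹ = (2 : ℝ)⁻¹ := by
        rw [← mul_inv, Real.mul_self_sqrt two_pos.le]
      ext ⟨i, j⟩
      simp only [symmetrize_apply, hx₀, PiLp.smul_apply, PiLp.add_apply, swapEquiv_apply,
        PiLp.single_apply, smul_eq_mul, Prod.swap_prod_mk, Prod.mk.injEq]
      by_cases hij : i = k ∧ j = k
      · simp only [hij, and_self, if_true]
        linear_combination 2 * m * h2
      · rw [if_neg hij, if_neg (fun h => hij h.symm), if_neg hij]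
        simp
    refine ⟨x₀, ?_⟩
    have hχ0 : χ (symmetrize p x₀) = 0 := by
      rw [hs]
      refine Finset.sum_eq_zero fun j _ => ?_
      simp [hk0.symm]
    refine ⟨by simpa [hχ0] using hc, ?_⟩
    simp only [Set.mem_ofPred_eq]
    rw [hL, hχ0, add_zero, hs]
    set A := spiked (unvec (EuclideanSpace.single (k, k) m)) v with hA
    have hA00 : A 0 0 = v := by simp [hA, spiked, hk0.symm]
    have hAkk : A k k = m := by simp [hA, spiked, hk0]
    have htop : m ≤ topEig A := by
      have := le_topEig A (x := EuclideanSpace.single k 1) (by simp)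
      simpa [hAkk] using this
    rw [hA00]
    have h5 : √c < topEig A - v := by
      have := le_abs_self v
      linarith
    calc c = √c ^ 2 := (Real.sq_sqrt hc.le).symm
      _ < (topEig A - v) ^ 2 := by gcongr
  have hdisj : Disjoint {x | c < χ x} U := by
    refine Set.disjoint_left.mpr fun x hx hxU => ?_
    have h6 : χ x < c := hxU.1
    exact lt_asymm (show c < χ x from hx) h6
  have hsub : {x | c < χ x} ∪ U ⊆ {x | c < limitStat (spiked (unvec x) v)} := by
    rintro x (hx | hx)
    · simp only [Set.mem_ofPred_eq] at hx ⊢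
      rw [hL]
      nlinarith [sq_nonneg (topEig (spiked (unvec x) v) - spiked (unvec x) v 0 0)]
    · exact hx.2
  rw [h1]
  calc μ {x | c < χ x} < μ {x | c < χ x} + μ U :=
        ENNReal.lt_add_right (measure_ne_top _ _) hUpos
    _ = μ ({x | c < χ x} ∪ U) := (measure_union hdisj hUo.measurableSet).symm
    _ ≤ _ := measure_mono hsub

end

/-! ### Moments of Gaussian quadratic forms -/

theorem integral_pow_four_gaussianReal : ∫ x, x ^ 4 ∂gaussianReal 0 1 = 3 := by
  have h : ∫ x, x ^ 4 ∂gaussianReal 0 1 =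
      iteratedDeriv 4 (mgf (fun x => x) (gaussianReal 0 1)) 0 := by
    rw [iteratedDeriv_mgf_zero] <;> simp
  have h0 : mgf (fun x => x) (gaussianReal 0 1) = fun t => Real.exp (t ^ 2 / 2) := by
    rw [mgf_fun_id_gaussianReal]; ext t; simp
  have he : ∀ t : ℝ, HasDerivAt (fun t => Real.exp (t ^ 2 / 2)) (t * Real.exp (t ^ 2 / 2)) t := by
    intro t
    have := ((hasDerivAt_pow 2 t).div_const 2).exp
    convert this using 1
    simp; ring
  have h1 : deriv (fun t : ℝ => Real.exp (t ^ 2 / 2)) = fun t => t * Real.exp (t ^ 2 / 2) :=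
    funext fun t => (he t).deriv
  have h2 : deriv (fun t : ℝ => t * Real.exp (t ^ 2 / 2)) =
      fun t => (1 + t ^ 2) * Real.exp (t ^ 2 / 2) := funext fun t => by
    refine (((hasDerivAt_id' t).mul (he t)).congr_deriv ?_).deriv
    ring
  have h3 : deriv (fun t : ℝ => (1 + t ^ 2) * Real.exp (t ^ 2 / 2)) =
      fun t => (3 * t + t ^ 3) * Real.exp (t ^ 2 / 2) := funext fun t => by
    refine ((((hasDerivAt_pow 2 t).const_add 1).mul (he t)).congr_deriv ?_).deriv
    simp; ring
  have h4 : deriv (fun t : ℝ => (3 * t + t ^ 3) * Real.exp (t ^ 2 / 2)) =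
      fun t => (3 + 6 * t ^ 2 + t ^ 4) * Real.exp (t ^ 2 / 2) := funext fun t => by
    refine (((((hasDerivAt_id' t).const_mul 3).add (hasDerivAt_pow 3 t)).mul
      (he t)).congr_deriv ?_).deriv
    simp; ring
  rw [h, h0, iteratedDeriv_succ', iteratedDeriv_succ', iteratedDeriv_succ', iteratedDeriv_one,
    h1, h2, h3, h4]
  simp

theorem memLp_sq_gaussianReal : MemLp (fun x : ℝ => x ^ 2) 2 (gaussianReal 0 1) := by
  rw [memLp_two_iff_integrable_sq (by fun_prop)]
  have := (memLp_id_gaussianReal (μ := 0) (v := 1) 4).integrable_norm_pow (by norm_num)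
  refine this.congr (ae_of_all _ fun x => ?_)
  simp [← pow_mul, Even.pow_abs (show Even 4 by decide)]

theorem integral_sq_gaussianReal : ∫ x, x ^ 2 ∂gaussianReal 0 1 = 1 := by
  have := variance_of_integral_eq_zero (X := fun x : ℝ => x) (μ := gaussianReal 0 1)
    (by fun_prop) (by simp)
  rw [← this]; simp

theorem variance_sq_gaussianReal : Var[fun x => x ^ 2; gaussianReal 0 1] = 2 := by
  rw [variance_eq_sub memLp_sq_gaussianReal]
  have : ((fun x : ℝ => x ^ 2) ^ 2) = fun x => x ^ 4 := by
    ext x; simp [← pow_mul]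
  rw [this, integral_pow_four_gaussianReal, integral_sq_gaussianReal]
  norm_num

/-- The quadratic form of a matrix, given by its vectorization. -/
def quadForm {p : ℕ} (t : EuclideanSpace ℝ (Fin p × Fin p)) (g : EuclideanSpace ℝ (Fin p)) : ℝ :=
  g.ofLp ⬝ᵥ (unvec t *ᵥ g.ofLp)

section

variable {p : ℕ}

theorem continuous_quadForm_right (t : EuclideanSpace ℝ (Fin p × Fin p)) :
    Continuous (quadForm t) :=
  continuous_quadForm.comp (Continuous.prodMk_right (unvec t))

theorem inner_vec_vecMulVec (t : EuclideanSpace ℝ (Fin p × Fin p)) (g : EuclideanSpace ℝ (Fin p)) :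
    inner ℝ (WithLp.toLp 2 (vecMulVec g.ofLp g.ofLp).vec) t = quadForm t g := by
  rw [inner_eq_dotProduct, quadForm, dotProduct, Fintype.sum_prod_type, Finset.sum_comm]
  simp only [dotProduct, mulVec, Finset.mul_sum, vec, vecMulVec_apply, unvec_apply]
  refine Finset.sum_congr rfl fun i _ => Finset.sum_congr rfl fun j _ => ?_
  ring

theorem inner_vec_one (t : EuclideanSpace ℝ (Fin p × Fin p)) :
    inner ℝ (WithLp.toLp 2 (1 : Matrix (Fin p) (Fin p) ℝ).vec) t = (unvec t).trace := by
  rw [inner_eq_dotProduct, dotProduct, Fintype.sum_prod_type]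
  simp [vec, one_apply, Matrix.trace]

/-- A quadratic form of a standard Gaussian vector is a weighted sum of squares of independent
standard Gaussian variables. -/
theorem exists_quadForm_eq_sum_sq (t : EuclideanSpace ℝ (Fin p × Fin p)) :
    ∃ (b : OrthonormalBasis (Fin p) ℝ (EuclideanSpace ℝ (Fin p))) (c : Fin p → ℝ),
      (∀ x : Fin p → ℝ, quadForm t (∑ i, x i • b i) = ∑ j, c j * x j ^ 2) ∧
      ∑ j, c j = (unvec t).trace ∧ 2 * ∑ j, c j ^ 2 = ‖symmetrize p t‖ ^ 2 := by
  -- A quadratic form sees only the symmetric part of `t`, which is `S / √2`. The weights `c` are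
  -- therefore the eigenvalues of `S` divided by `√2`, and `2 ∑ c²` is the trace of `S²`.
  set S := unvec (symmetrize p t) with hS
  have hSs : S.IsSymm := isSymm_unvec_symmetrize t
  have hSh := isHermitian_of_isSymm hSs
  have h2 : (√2)⁻¹ * (√2)⁻¹ = (2 : ℝ)⁻¹ := by
    rw [← mul_inv, Real.mul_self_sqrt two_pos.le]
  have hSe : S = (√2)⁻¹ • (unvec t + (unvec t)ᵀ) := by
    ext i j; simp [hS, symmetrize_apply, mul_add]
  obtain ⟨b, hb, -⟩ := exists_eigenbasis hSh
  refine ⟨b, fun j => (√2)⁻¹ * eigval S j, fun x => ?_, ?_, ?_⟩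
  · have h1 : ∀ g : EuclideanSpace ℝ (Fin p),
        quadForm t g = (√2)⁻¹ * (g.ofLp ⬝ᵥ (S *ᵥ g.ofLp)) := by
      intro g
      have hT : g.ofLp ⬝ᵥ ((unvec t)ᵀ *ᵥ g.ofLp) = g.ofLp ⬝ᵥ (unvec t *ᵥ g.ofLp) := by
        rw [mulVec_transpose, dotProduct_comm, ← dotProduct_mulVec]
      rw [hSe, smul_mulVec, dotProduct_smul, add_mulVec, dotProduct_add, hT, smul_eq_mul,
        ← mul_assoc, h2, quadForm]
      ring
    rw [h1, dotProduct_mulVec_eq_sum hSh b hb, Finset.mul_sum]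
    refine Finset.sum_congr rfl fun j _ => ?_
    have : inner ℝ (b j) (∑ i, x i • b i) = x j := by
      simpa using! b.orthonormal.inner_right_fintype x j
    rw [this]; ring
  · have := trace_pow_eq_sum_eigval hSh 1
    simp only [pow_one] at this
    rw [← Finset.mul_sum, ← this, hSe, trace_smul, trace_add, trace_transpose, smul_eq_mul,
      ← mul_assoc, h2]
    ring
  · have := trace_pow_eq_sum_eigval hSh 2
    simp_rw [mul_pow]
    rw [← Finset.mul_sum, ← this, sq (√2)⁻¹, h2, ← mul_assoc, mul_inv_cancel₀ two_ne_zero, one_mul,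
      sq S, ← real_inner_self_eq_norm_sq, inner_eq_dotProduct]
    have hv : (symmetrize p t).ofLp = S.vec := rfl
    rw [hv, vec_dotProduct_vec, hSs.eq]

theorem memLp_quadForm (t : EuclideanSpace ℝ (Fin p × Fin p)) :
    MemLp (quadForm t) 2 (stdGaussian (EuclideanSpace ℝ (Fin p))) := by
  obtain ⟨b, c, h1, -, -⟩ := exists_quadForm_eq_sum_sq t
  rw [stdGaussian_eq_map_pi_orthonormalBasis b,
    memLp_map_measure_iff (continuous_quadForm_right t).aestronglyMeasurable
      (Measurable.aemeasurable (by fun_prop))]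
  simp only [Function.comp_def, h1]
  refine memLp_finsetSum _ fun j _ => MemLp.const_mul ?_ _
  exact memLp_sq_gaussianReal.comp_measurePreserving
    (measurePreserving_eval (fun _ : Fin p => gaussianReal 0 1) j)

theorem integral_quadForm (t : EuclideanSpace ℝ (Fin p × Fin p)) :
    ∫ g, quadForm t g ∂stdGaussian (EuclideanSpace ℝ (Fin p)) = (unvec t).trace := by
  obtain ⟨b, c, h1, h2, -⟩ := exists_quadForm_eq_sum_sq t
  rw [stdGaussian_eq_map_pi_orthonormalBasis b,
    integral_map (Measurable.aemeasurable (by fun_prop))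
      (continuous_quadForm_right t).aestronglyMeasurable]
  simp only [h1]
  rw [integral_finsetSum, ← h2]
  · refine Finset.sum_congr rfl fun j _ => ?_
    rw [integral_const_mul, integral_comp_eval (μ := fun _ : Fin p => gaussianReal 0 1)
      (f := fun x : ℝ => x ^ 2) (by fun_prop), integral_sq_gaussianReal, mul_one]
  · intro j _
    refine Integrable.const_mul ?_ _
    exact (memLp_sq_gaussianReal.comp_measurePreserving
      (measurePreserving_eval (fun _ : Fin p => gaussianReal 0 1) j)).integrable one_le_two

theorem variance_quadForm (t : EuclideanSpace ℝ (Fin p × Fin p)) :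
    Var[quadForm t; stdGaussian (EuclideanSpace ℝ (Fin p))] = ‖symmetrize p t‖ ^ 2 := by
  obtain ⟨b, c, h1, -, h2⟩ := exists_quadForm_eq_sum_sq t
  rw [stdGaussian_eq_map_pi_orthonormalBasis b,
    variance_map (continuous_quadForm_right t).aemeasurable
      (Measurable.aemeasurable (by fun_prop))]
  have h3 : quadForm t ∘ (fun x : Fin p → ℝ => ∑ i, x i • b i) =
      ∑ j, fun x : Fin p → ℝ => (fun y => c j * y ^ 2) (x j) := by
    ext x
    simp [h1]
  rw [h3, variance_sum_pi (fun j => memLp_sq_gaussianReal.const_mul (c j)), ← h2, Finset.mul_sum]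
  refine Finset.sum_congr rfl fun j _ => ?_
  rw [variance_const_mul, variance_sq_gaussianReal]; ring

end

/-! ### Central limit theorem for the sample covariance matrix -/

section

variable {p : ℕ}

/-- The law of an infinite sequence of independent standard Gaussian vectors. -/
def seqLaw (p : ℕ) : Measure (ℕ → EuclideanSpace ℝ (Fin p)) :=
  Measure.infinitePi fun _ => stdGaussian (EuclideanSpace ℝ (Fin p))

instance : IsProbabilityMeasure (seqLaw p) := by
  unfold seqLaw; infer_instance

/-- The vectorization of `√n (S - I)`, where `S` is the sample covariance matrix. -/
def scaledCov {n : ℕ} (g : Fin n → EuclideanSpace ℝ (Fin p)) : EuclideanSpace ℝ (Fin p × Fin p) :=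
  WithLp.toLp 2 (√n • (sampleCov g - 1)).vec

/-- The part of `scaledCov` that is linear in the second moments. -/
def scaledMoment (n : ℕ) (ω : ℕ → EuclideanSpace ℝ (Fin p)) :
    EuclideanSpace ℝ (Fin p × Fin p) :=
  (√n)⁻¹ • ∑ k ∈ Finset.range n,
    (WithLp.toLp 2 (vecMulVec (ω k).ofLp (ω k).ofLp).vec -
      WithLp.toLp 2 (1 : Matrix (Fin p) (Fin p) ℝ).vec)

theorem continuous_vec_vecMulVec :
    Continuous fun g : EuclideanSpace ℝ (Fin p) =>
      (WithLp.toLp 2 (vecMulVec g.ofLp g.ofLp).vec : EuclideanSpace ℝ (Fin p × Fin p)) := by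
  refine (PiLp.continuous_toLp 2 _).comp (continuous_pi fun a => ?_)
  simp only [vec, vecMulVec_apply]
  fun_prop

theorem measurable_scaledMoment (n : ℕ) : Measurable (scaledMoment (p := p) n) := by
  have : Continuous (scaledMoment (p := p) n) := by
    unfold scaledMoment
    have h (k : ℕ) : Continuous fun ω : ℕ → EuclideanSpace ℝ (Fin p) =>
        (WithLp.toLp 2 (vecMulVec (ω k).ofLp (ω k).ofLp).vec :
          EuclideanSpace ℝ (Fin p × Fin p)) :=
      continuous_vec_vecMulVec.comp (continuous_apply k)
    fun_prop
  exact this.measurable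

theorem inner_scaledMoment (n : ℕ) (ω : ℕ → EuclideanSpace ℝ (Fin p))
    (t : EuclideanSpace ℝ (Fin p × Fin p)) :
    inner ℝ (scaledMoment n ω) t =
      (√n)⁻¹ * (∑ k ∈ Finset.range n, quadForm t (ω k) - n * (unvec t).trace) := by
  rw [scaledMoment, real_inner_smul_left, sum_inner]
  simp only [inner_sub_left, inner_vec_vecMulVec, inner_vec_one, Finset.sum_sub_distrib]
  simp

theorem hasLaw_eval_seqLaw (k : ℕ) :
    HasLaw (fun ω : ℕ → EuclideanSpace ℝ (Fin p) => ω k)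
      (stdGaussian (EuclideanSpace ℝ (Fin p))) (seqLaw p) :=
  (measurePreserving_eval_infinitePi (fun _ => stdGaussian (EuclideanSpace ℝ (Fin p))) k).hasLaw

theorem iIndepFun_comp_seqLaw {f : EuclideanSpace ℝ (Fin p) → ℝ} (hf : Measurable f) :
    iIndepFun (fun (k : ℕ) (ω : ℕ → EuclideanSpace ℝ (Fin p)) => f (ω k)) (seqLaw p) :=
  iIndepFun_infinitePi (X := fun _ => f) fun _ => hf

theorem hasLaw_quadForm_eval (t : EuclideanSpace ℝ (Fin p × Fin p)) (k : ℕ) :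
    HasLaw (fun ω : ℕ → EuclideanSpace ℝ (Fin p) => quadForm t (ω k))
      ((stdGaussian (EuclideanSpace ℝ (Fin p))).map (quadForm t)) (seqLaw p) :=
  HasLaw.comp (Y := quadForm t) ⟨(continuous_quadForm_right t).aemeasurable, rfl⟩
    (hasLaw_eval_seqLaw k)

theorem identDistrib_quadForm_eval (t : EuclideanSpace ℝ (Fin p × Fin p)) (k : ℕ) :
    IdentDistrib (fun ω : ℕ → EuclideanSpace ℝ (Fin p) => quadForm t (ω k))
      (fun ω => quadForm t (ω 0)) (seqLaw p) (seqLaw p) :=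
  ⟨(hasLaw_quadForm_eval t k).aemeasurable, (hasLaw_quadForm_eval t 0).aemeasurable,
    (hasLaw_quadForm_eval t k).map_eq.trans (hasLaw_quadForm_eval t 0).map_eq.symm⟩

theorem identDistrib_quadForm (t : EuclideanSpace ℝ (Fin p × Fin p)) (k : ℕ) :
    IdentDistrib (fun ω : ℕ → EuclideanSpace ℝ (Fin p) => quadForm t (ω k))
      (quadForm t) (seqLaw p) (stdGaussian (EuclideanSpace ℝ (Fin p))) :=
  ⟨(hasLaw_quadForm_eval t k).aemeasurable, (continuous_quadForm_right t).aemeasurable,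
    (hasLaw_quadForm_eval t k).map_eq⟩

theorem integral_quadForm_eval (t : EuclideanSpace ℝ (Fin p × Fin p)) (k : ℕ) :
    ∫ ω, quadForm t (ω k) ∂seqLaw p = (unvec t).trace :=
  (identDistrib_quadForm t k).integral_eq.trans (integral_quadForm t)

theorem variance_quadForm_eval (t : EuclideanSpace ℝ (Fin p × Fin p)) (k : ℕ) :
    Var[fun ω => quadForm t (ω k); seqLaw p] = ‖symmetrize p t‖ ^ 2 :=
  (identDistrib_quadForm t k).variance_eq.trans (variance_quadForm t)

theorem memLp_quadForm_eval (t : EuclideanSpace ℝ (Fin p × Fin p)) (k : ℕ) :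
    MemLp (fun ω : ℕ → EuclideanSpace ℝ (Fin p) => quadForm t (ω k)) 2 (seqLaw p) :=
  (identDistrib_quadForm t k).memLp_iff.2 (memLp_quadForm t)

/-- The characteristic function of a random vector is determined by that of its projections. -/
theorem charFun_map_eq_charFun_inner {Ω E : Type*} [MeasurableSpace Ω] [NormedAddCommGroup E]
    [InnerProductSpace ℝ E] [MeasurableSpace E] [BorelSpace E] [SecondCountableTopology E]
    {μ : Measure Ω} {X : Ω → E} (hX : AEMeasurable X μ) (t : E) :
    charFun (μ.map X) t = charFun (μ.map fun ω => inner ℝ (X ω) t) 1 := by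
  rw [charFun_apply, charFun_apply, integral_map hX (by fun_prop),
    integral_map (by fun_prop) (by fun_prop)]
  simp

theorem tendsto_charFun_of_clt {Ω : Type*} [MeasurableSpace Ω] {P : Measure Ω}
    [IsProbabilityMeasure P] {X : ℕ → Ω → ℝ} (hX : MemLp (X 0) 2 P) (hindep : iIndepFun X P)
    (hident : ∀ k, IdentDistrib (X k) (X 0) P P) (t : ℝ) :
    Tendsto (fun n : ℕ => charFun (P.map fun ω =>
      (√n)⁻¹ * (∑ k ∈ Finset.range n, X k ω - n * P[X 0])) t) atTop
      (𝓝 (charFun (gaussianReal 0 Var[X 0; P].toNNReal) t)) := by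
  have hclt := tendstoInDistribution_inv_sqrt_mul_sum_sub (Y := id)
    (P' := gaussianReal 0 Var[X 0; P].toNNReal) HasLaw.id hX hindep hident
  simpa using ProbabilityMeasure.tendsto_iff_tendsto_charFun.1 hclt.tendsto t

theorem tendsto_charFun_quadForm (t : EuclideanSpace ℝ (Fin p × Fin p)) :
    Tendsto (fun n : ℕ => charFun ((seqLaw p).map fun ω =>
      (√n)⁻¹ * (∑ k ∈ Finset.range n, quadForm t (ω k) - n * (unvec t).trace)) 1) atTop
      (𝓝 (charFun (gaussianReal 0 (‖symmetrize p t‖ ^ 2).toNNReal) 1)) := by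
  rw [← integral_quadForm_eval t 0, ← variance_quadForm_eval t 0]
  exact tendsto_charFun_of_clt (memLp_quadForm_eval t 0)
    (iIndepFun_comp_seqLaw (continuous_quadForm_right t).measurable)
    (identDistrib_quadForm_eval t) 1

/-- **Central limit theorem** for the second moments of Gaussian vectors. -/
theorem tendstoInDistribution_scaledMoment {Ω : Type*} [MeasurableSpace Ω] {P : Measure Ω}
    [IsProbabilityMeasure P] {Z : Ω → EuclideanSpace ℝ (Fin p × Fin p)}
    (hZ : HasLaw Z (multivariateGaussian 0 (1 + commutationMatrix p)) P) :
    TendstoInDistribution (scaledMoment (p := p)) atTop Z (fun _ => seqLaw p) P where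
  forall_aemeasurable n := (measurable_scaledMoment n).aemeasurable
  aemeasurable_limit := hZ.aemeasurable
  tendsto := by
    -- Lévy continuity and the Cramér–Wold device: the projection on `t` is a normalized sum of
    -- independent quadratic forms, with variance `‖symmetrize p t‖²`, which is the quadratic form
    -- of `I + K` at `t`.
    refine ProbabilityMeasure.tendsto_iff_tendsto_charFun.2 fun t => ?_
    have h2 : charFun (P.map Z) t =
        charFun (gaussianReal 0 (‖symmetrize p t‖ ^ 2).toNNReal) 1 := by
      rw [hZ.map_eq, charFun_multivariateGaussian posSemidef_one_add_commutationMatrix,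
        one_add_commutationMatrix_quadForm, charFun_gaussianReal]
      simp [Real.coe_toNNReal _ (sq_nonneg ‖symmetrize p t‖)]
    simp only [ProbabilityMeasure.coe_mk]
    rw [h2]
    refine (tendsto_charFun_quadForm t).congr fun n => ?_
    rw [charFun_map_eq_charFun_inner (measurable_scaledMoment n).aemeasurable]
    simp only [inner_scaledMoment]

theorem sampleCov_eq {n : ℕ} (g : Fin n → EuclideanSpace ℝ (Fin p)) :
    sampleCov g = (1 / n : ℝ) • ∑ i, vecMulVec (g i).ofLp (g i).ofLp -
      vecMulVec (sampleMean g).ofLp (sampleMean g).ofLp := by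
  rcases Nat.eq_zero_or_pos n with rfl | hn
  · simp [sampleCov, sampleMean]
  have hn' : (n : ℝ) ≠ 0 := by positivity
  set m := sampleMean g with hm
  have hsum : ∑ i, (g i).ofLp = (n : ℝ) • m.ofLp := by
    rw [hm, sampleMean, WithLp.ofLp_smul, WithLp.ofLp_sum, smul_smul]
    field_simp
    simp
  have h1 : ∀ i, vecMulVec (g i - m).ofLp (g i - m).ofLp = vecMulVec (g i).ofLp (g i).ofLp -
      vecMulVec (g i).ofLp m.ofLp - vecMulVec m.ofLp (g i).ofLp + vecMulVec m.ofLp m.ofLp := by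
    intro i
    ext a b
    simp only [WithLp.ofLp_sub, vecMulVec_apply, Pi.sub_apply, Matrix.add_apply, Matrix.sub_apply]
    ring
  have h2 : ∑ i, vecMulVec (g i).ofLp m.ofLp = (n : ℝ) • vecMulVec m.ofLp m.ofLp := by
    ext a b
    have := congrFun hsum a
    simp only [Finset.sum_apply, Pi.smul_apply, smul_eq_mul] at this
    simp only [Matrix.sum_apply, vecMulVec_apply, Matrix.smul_apply, smul_eq_mul]
    rw [← Finset.sum_mul, this]; ring
  have h3 : ∑ i, vecMulVec m.ofLp (g i).ofLp = (n : ℝ) • vecMulVec m.ofLp m.ofLp := by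
    ext a b
    have := congrFun hsum b
    simp only [Finset.sum_apply, Pi.smul_apply, smul_eq_mul] at this
    simp only [Matrix.sum_apply, vecMulVec_apply, Matrix.smul_apply, smul_eq_mul]
    rw [← Finset.mul_sum, this]; ring
  rw [sampleCov, ← hm]
  simp only [h1, Finset.sum_add_distrib, Finset.sum_sub_distrib, h2, h3, Finset.sum_const,
    Finset.card_univ, Fintype.card_fin]
  rw [← Nat.cast_smul_eq_nsmul ℝ, smul_add, smul_sub, smul_sub, smul_smul,
    one_div_mul_cancel hn', one_smul]
  abel

/-- Centering at the sample mean costs one rank-one term, whose norm `√n ‖mean‖²` has expectation `p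
/ √n`; it is therefore negligible in probability. -/
theorem scaledCov_sub_scaledMoment (n : ℕ) (ω : ℕ → EuclideanSpace ℝ (Fin p)) :
    scaledCov (fun i : Fin n => ω i) - scaledMoment n ω =
      WithLp.toLp 2 (-(√n • vecMulVec (sampleMean fun i : Fin n => ω i).ofLp
        (sampleMean fun i : Fin n => ω i).ofLp)).vec := by
  rcases Nat.eq_zero_or_pos n with rfl | hn
  · simp [scaledCov, scaledMoment]
  have hn' : (0 : ℝ) < n := by positivity
  have hs : √(n : ℝ) * (1 / n) = (√n)⁻¹ := by
    rw [eq_comm, inv_eq_iff_eq_inv]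
    rw [mul_inv, one_div, inv_inv]
    field_simp
    exact Real.sq_sqrt hn'.le
  have hs2 : (√(n : ℝ))⁻¹ * n = √n := by
    field_simp
    exact (Real.sq_sqrt hn'.le).symm
  have h1 : scaledMoment n ω = WithLp.toLp 2 ((√n)⁻¹ •
      (∑ i : Fin n, vecMulVec (ω i).ofLp (ω i).ofLp) - √n • 1 : Matrix (Fin p) (Fin p) ℝ).vec := by
    rw [scaledMoment, Finset.sum_sub_distrib, Finset.sum_range
      (fun k => (WithLp.toLp 2 (vecMulVec (ω k).ofLp (ω k).ofLp).vec :
        EuclideanSpace ℝ (Fin p × Fin p)))]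
    simp only [Finset.sum_const, Finset.card_range, vec_sub, vec_smul, vec_sum, WithLp.toLp_sub,
      WithLp.toLp_smul, WithLp.toLp_sum, smul_sub]
    rw [← Nat.cast_smul_eq_nsmul ℝ, smul_smul, hs2]
  rw [h1, scaledCov, sampleCov_eq, ← WithLp.toLp_sub, ← vec_sub, smul_sub, smul_sub, smul_smul, hs]
  congr 2
  abel

theorem integral_sq_sum_coord (n : ℕ) (a : Fin p) :
    Integrable (fun ω : ℕ → EuclideanSpace ℝ (Fin p) => (∑ k ∈ Finset.range n, ω k a) ^ 2)
      (seqLaw p) ∧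
    ∫ ω, (∑ k ∈ Finset.range n, ω k a) ^ 2 ∂seqLaw p = n := by
  have hlaw : ∀ k, HasLaw (fun ω : ℕ → EuclideanSpace ℝ (Fin p) => ω k a) (gaussianReal 0 1)
      (seqLaw p) := by
    intro k
    have h1 := (measurePreserving_eval_multivariateGaussian (μ := (0 : EuclideanSpace ℝ (Fin p)))
      (S := (1 : Matrix (Fin p) (Fin p) ℝ)) PosSemidef.one (i := a)).hasLaw
    rw [multivariateGaussian_zero_one] at h1
    simpa using! h1.comp (hasLaw_eval_seqLaw k)
  have hmem : ∀ k, MemLp (fun ω : ℕ → EuclideanSpace ℝ (Fin p) => ω k a) 2 (seqLaw p) := by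
    intro k
    have := memLp_id_gaussianReal' (μ := 0) (v := 1) 2 (by simp)
    rw [← (hlaw k).map_eq, memLp_map_measure_iff (by fun_prop) (hlaw k).aemeasurable] at this
    exact this
  have hsum : MemLp (fun ω : ℕ → EuclideanSpace ℝ (Fin p) => ∑ k ∈ Finset.range n, ω k a) 2
      (seqLaw p) := memLp_finsetSum _ fun k _ => hmem k
  refine ⟨hsum.integrable_sq, ?_⟩
  have h0 : ∀ k, ∫ ω, ω k a ∂seqLaw p = 0 := by
    intro k
    have := integral_id_gaussianReal (μ := 0) (v := 1)
    rwa [← (hlaw k).map_eq, integral_map (hlaw k).aemeasurable (by fun_prop)] at this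
  have hv : ∀ k, Var[fun ω : ℕ → EuclideanSpace ℝ (Fin p) => ω k a; seqLaw p] = 1 := by
    intro k
    have := variance_id_gaussianReal (μ := 0) (v := 1)
    rw [← (hlaw k).map_eq, variance_map (by fun_prop) (hlaw k).aemeasurable] at this
    simpa using! this
  have hind := iIndepFun_comp_seqLaw (p := p) (f := fun g => g a) (by fun_prop)
  have h1 := IndepFun.variance_sum (s := Finset.range n) (fun k _ => hmem k)
    (fun i _ j _ hij => hind.indepFun hij)
  rw [Finset.sum_congr rfl fun k _ => hv k] at h1
  rw [variance_of_integral_eq_zero (by fun_prop)] at h1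
  · simpa using h1
  · simp only [Finset.sum_apply]
    rw [integral_finsetSum _ fun k _ => (hmem k).integrable one_le_two]
    simp [h0]

theorem norm_vec_vecMulVec (g : EuclideanSpace ℝ (Fin p)) :
    ‖(WithLp.toLp 2 (vecMulVec g.ofLp g.ofLp).vec : EuclideanSpace ℝ (Fin p × Fin p))‖ =
      ‖g‖ ^ 2 := by
  have h : ‖(WithLp.toLp 2 (vecMulVec g.ofLp g.ofLp).vec : EuclideanSpace ℝ (Fin p × Fin p))‖ ^ 2 =
      (‖g‖ ^ 2) ^ 2 := by
    rw [EuclideanSpace.real_norm_sq_eq, EuclideanSpace.real_norm_sq_eq, Fintype.sum_prod_type,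
      sq (∑ i, g i ^ 2), Finset.sum_mul_sum]
    refine Finset.sum_congr rfl fun i _ => Finset.sum_congr rfl fun j _ => ?_
    simp only [vec, vecMulVec_apply]; ring
  exact (pow_left_inj₀ (norm_nonneg _) (sq_nonneg _) two_ne_zero).mp h

theorem continuous_scaledCov (n : ℕ) :
    Continuous (scaledCov : (Fin n → EuclideanSpace ℝ (Fin p)) → _) := by
  refine (PiLp.continuous_toLp 2 _).comp (continuous_pi fun a => ?_)
  simp only [vec, Matrix.smul_apply, Matrix.sub_apply, sampleCov, sampleMean, Matrix.sum_apply,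
    vecMulVec_apply]
  fun_prop

/-- **Central limit theorem** for the sample covariance matrix of standard Gaussian vectors. -/
theorem tendstoInDistribution_scaledCov {Ω : Type*} [MeasurableSpace Ω] {P : Measure Ω}
    [IsProbabilityMeasure P] {Z : Ω → EuclideanSpace ℝ (Fin p × Fin p)}
    (hZ : HasLaw Z (multivariateGaussian 0 (1 + commutationMatrix p)) P) :
    TendstoInDistribution
      (fun n (ω : ℕ → EuclideanSpace ℝ (Fin p)) => scaledCov fun i : Fin n => ω i) atTop Z
      (fun _ => seqLaw p) P := by
  have hmeas : ∀ n, Measurable fun ω : ℕ → EuclideanSpace ℝ (Fin p) =>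
      scaledCov fun i : Fin n => ω i := fun n =>
    (continuous_scaledCov n).measurable.comp (by fun_prop)
  refine tendstoInDistribution_of_tendstoInMeasure_sub _ _ (tendstoInDistribution_scaledMoment hZ)
    ?_ fun n => (hmeas n).aemeasurable
  rw [tendstoInMeasure_iff_measureReal_norm]
  intro ε hε
  have hlim : Tendsto (fun n : ℕ => ε⁻¹ * (p * (√n)⁻¹)) atTop (𝓝 0) := by
    have := (tendsto_inv_atTop_zero.comp
      (Real.tendsto_sqrt_atTop.comp tendsto_natCast_atTop_atTop)).const_mul (p : ℝ)
    simpa using this.const_mul ε⁻¹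
  refine squeeze_zero' (Eventually.of_forall fun _ => measureReal_nonneg) ?_ hlim
  filter_upwards [eventually_gt_atTop 0] with n hn
  have hn' : (0 : ℝ) < n := by exact_mod_cast hn
  have hsn : √(n : ℝ) * √n = n := Real.mul_self_sqrt hn'.le
  have hs0 : 0 < √(n : ℝ) := Real.sqrt_pos.mpr hn'
  have hnorm : ∀ ω : ℕ → EuclideanSpace ℝ (Fin p),
      ‖(scaledCov (fun i : Fin n => ω i) - scaledMoment n ω)‖ =
        ∑ a, √n * (n : ℝ)⁻¹ ^ 2 * (∑ k ∈ Finset.range n, ω k a) ^ 2 := by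
    intro ω
    rw [scaledCov_sub_scaledMoment, vec_neg, vec_smul, WithLp.toLp_neg, WithLp.toLp_smul, norm_neg,
      norm_smul, norm_vec_vecMulVec, Real.norm_of_nonneg hs0.le, EuclideanSpace.real_norm_sq_eq,
      Finset.mul_sum]
    refine Finset.sum_congr rfl fun a _ => ?_
    have : sampleMean (fun i : Fin n => ω i) a = (n : ℝ)⁻¹ * ∑ k ∈ Finset.range n, ω k a := by
      rw [Finset.sum_range]
      simp [sampleMean]
    rw [this]; ring
  have hint : ∫ ω, ‖(scaledCov (fun i : Fin n => ω i) - scaledMoment n ω)‖ ∂seqLaw p =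
      p * (√n)⁻¹ := by
    simp only [hnorm]
    rw [integral_finsetSum _ fun a _ => (integral_sq_sum_coord n a).1.const_mul _]
    simp only [integral_const_mul, (integral_sq_sum_coord n _).2, Finset.sum_const,
      Finset.card_univ, Fintype.card_fin, nsmul_eq_mul]
    field_simp
    rw [sq, hsn]
  have hintg : Integrable (fun ω => ‖(scaledCov (fun i : Fin n => ω i) - scaledMoment n ω)‖)
      (seqLaw p) := by
    simp only [hnorm]
    exact integrable_finsetSum _ fun a _ => (integral_sq_sum_coord n a).1.const_mul _
  -- Markov's inequality for the norm of the centering term.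
  have hmark := mul_meas_ge_le_integral_of_nonneg (ae_of_all _ fun ω => norm_nonneg _) hintg ε
  rw [hint] at hmark
  rw [le_inv_mul_iff₀ hε]
  simpa using hmark

end

/-! ### Reduction to standard Gaussian samples -/

section

variable {p : ℕ}

theorem isSymm_sampleCov {n : ℕ} (x : Fin n → EuclideanSpace ℝ (Fin p)) :
    (sampleCov x).IsSymm := by
  simp [IsSymm, sampleCov, transpose_sum, transpose_vecMulVec]

theorem sampleCov_toEuclideanCLM {n : ℕ} (B : Matrix (Fin p) (Fin p) ℝ)
    (g : Fin n → EuclideanSpace ℝ (Fin p)) :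
    sampleCov (fun i => toEuclideanCLM (𝕜 := ℝ) B (g i)) = B * sampleCov g * Bᵀ := by
  have hm : sampleMean (fun i => toEuclideanCLM (𝕜 := ℝ) B (g i)) =
      toEuclideanCLM (𝕜 := ℝ) B (sampleMean g) := by
    simp only [sampleMean, map_smul, map_sum]
  have h1 : ∀ y : EuclideanSpace ℝ (Fin p),
      vecMulVec (toEuclideanCLM (𝕜 := ℝ) B y).ofLp (toEuclideanCLM (𝕜 := ℝ) B y).ofLp =
        B * vecMulVec y.ofLp y.ofLp * Bᵀ := by
    intro y
    rw [ofLp_toEuclideanCLM, mul_vecMulVec, vecMulVec_mul, vecMul_transpose]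
  simp only [sampleCov, hm, ← map_sub, h1, Matrix.mul_smul, Matrix.smul_mul, Matrix.mul_sum,
    Matrix.sum_mul]

theorem sampleCov_eq_one_add_scaledCov {n : ℕ} (hn : 0 < n)
    (g : Fin n → EuclideanSpace ℝ (Fin p)) :
    sampleCov g = 1 + (√n)⁻¹ • unvec (scaledCov g) := by
  have hs : √(n : ℝ) ≠ 0 := (Real.sqrt_pos.mpr (by exact_mod_cast hn)).ne'
  rw [scaledCov, unvec_toLp_vec, smul_smul, inv_mul_cancel₀ hs, one_smul]
  abel

theorem isSymm_unvec_scaledCov {n : ℕ} (g : Fin n → EuclideanSpace ℝ (Fin p)) :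
    (unvec (scaledCov g)).IsSymm := by
  rw [scaledCov, unvec_toLp_vec]
  exact ((isSymm_sampleCov g).sub isSymm_one).smul _

/-- Any factor `B` of the covariance serves, not only its symmetric square root; `R * spikeDiag` is
used below, so that the rotation cancels in the statistic. -/
theorem multivariateGaussian_mul_transpose (B : Matrix (Fin p) (Fin p) ℝ) :
    multivariateGaussian 0 (B * Bᵀ) =
      (stdGaussian (EuclideanSpace ℝ (Fin p))).map (toEuclideanCLM (𝕜 := ℝ) B) := by
  have : IsProbabilityMeasure
      ((stdGaussian (EuclideanSpace ℝ (Fin p))).map (toEuclideanCLM (𝕜 := ℝ) B)) :=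
    Measure.isProbabilityMeasure_map (by fun_prop)
  have hpos : (B * Bᵀ).PosSemidef := by
    simpa using posSemidef_self_mul_conjTranspose B
  apply Measure.ext_of_charFun
  ext t
  have hadj : ∀ x, inner ℝ (toEuclideanCLM (𝕜 := ℝ) B x) t =
      inner ℝ x (WithLp.toLp 2 (Bᵀ *ᵥ t.ofLp)) := by
    intro x
    rw [inner_eq_dotProduct, inner_eq_dotProduct, ofLp_toEuclideanCLM, mulVec_transpose,
      dotProduct_comm, dotProduct_mulVec, dotProduct_comm]
  have hq : t.ofLp ⬝ᵥ ((B * Bᵀ) *ᵥ t.ofLp) =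
      ‖(WithLp.toLp 2 (Bᵀ *ᵥ t.ofLp) : EuclideanSpace ℝ (Fin p))‖ ^ 2 := by
    rw [← real_inner_self_eq_norm_sq, inner_eq_dotProduct, ← mulVec_mulVec, dotProduct_mulVec,
      ← mulVec_transpose]
  rw [charFun_map_continuousLinearMap _ hadj, charFun_stdGaussian,
    charFun_multivariateGaussian hpos, hq]
  simp [neg_div]

theorem continuous_sampleCov (n : ℕ) :
    Continuous (sampleCov : (Fin n → EuclideanSpace ℝ (Fin p)) → _) := by
  refine continuous_pi fun a => continuous_pi fun b => ?_
  simp only [Matrix.smul_apply, sampleCov, sampleMean, Matrix.sum_apply, vecMulVec_apply]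
  fun_prop

/-- The symmetric part of the matrix with a given vectorization. -/
def symmPart (x : EuclideanSpace ℝ (Fin p × Fin p)) : Matrix (Fin p) (Fin p) ℝ :=
  (2⁻¹ : ℝ) • (unvec x + (unvec x)ᵀ)

theorem isSymm_symmPart (x : EuclideanSpace ℝ (Fin p × Fin p)) : (symmPart x).IsSymm := by
  simp [IsSymm, symmPart, add_comm]

theorem continuous_symmPart : Continuous (symmPart (p := p)) := by
  have := continuous_unvec (p := p)
  unfold symmPart
  fun_prop

/-- The mapping theorem lets vectorizations vary over a full neighbourhood, including nonsymmetric
matrices. `symmPart` extends the statistic continuously there without altering it where the random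
matrices live. -/
theorem symmPart_eq_unvec {x : EuclideanSpace ℝ (Fin p × Fin p)} (hx : (unvec x).IsSymm) :
    symmPart x = unvec x := by
  rw [symmPart, hx.eq, ← two_smul ℝ, smul_smul]
  norm_num

variable [NeZero p]

/-- Every unit vector is the first column of an orthogonal matrix. -/
theorem exists_orthogonal_mulVec_single {θ : EuclideanSpace ℝ (Fin p)} (hθ : ‖θ‖ = 1) :
    ∃ R : Matrix (Fin p) (Fin p) ℝ, R * Rᵀ = 1 ∧ R *ᵥ Pi.single 0 1 = θ.ofLp := by
  have hv : Orthonormal ℝ (({0} : Set (Fin p)).domRestrict fun _ => θ) := by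
    refine ⟨fun _ => hθ, fun i j hij => ?_⟩
    exact absurd (Subsingleton.elim i j) hij
  obtain ⟨b, hb⟩ := hv.exists_orthonormalBasis_extension_of_card_eq (by simp)
  refine ⟨Matrix.of fun i j => b j i, ?_, ?_⟩
  · rw [mul_eq_one_comm]
    ext i j
    have := orthonormal_iff_ite.mp b.orthonormal i j
    rw [inner_eq_dotProduct] at this
    simpa [mul_apply, dotProduct, one_apply] using this
  · ext i
    simp [hb 0 rfl]

theorem spikedCov_eq {θ : EuclideanSpace ℝ (Fin p)} {R : Matrix (Fin p) (Fin p) ℝ}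
    (hR : R * Rᵀ = 1) (hRθ : R *ᵥ Pi.single 0 1 = θ.ofLp) {r v : ℝ} (hrv : 0 ≤ 1 + r * v) :
    spikedCov θ r v = (R * spikeDiag √(1 + r * v)) * (R * spikeDiag √(1 + r * v))ᵀ := by
  have hD : spikeDiag (p := p) √(1 + r * v) * (spikeDiag √(1 + r * v))ᵀ =
      1 + (r * v) • vecMulVec (Pi.single 0 1) (Pi.single 0 1) := by
    ext i j
    simp only [spikeDiag, diagonal_transpose, diagonal_mul_diagonal, Matrix.add_apply,
      Matrix.smul_apply, vecMulVec_apply, smul_eq_mul]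
    by_cases hij : i = j
    · subst hij
      by_cases hi : i = 0
      · subst hi; simp [Real.mul_self_sqrt hrv]
      · simp [hi]
    · by_cases hi : i = 0
      · subst hi; simp [hij, Ne.symm hij]
      · simp [hij, hi]
  rw [transpose_mul, Matrix.mul_assoc, ← Matrix.mul_assoc (spikeDiag _), hD, Matrix.add_mul,
    Matrix.mul_add, Matrix.one_mul, hR, Matrix.smul_mul, Matrix.mul_smul, vecMulVec_mul,
    mul_vecMulVec, vecMul_transpose, hRθ, spikedCov]

/-- The sample is obtained from a sequence of standard Gaussian vectors by a linear map. -/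
theorem sampleLaw_eq_map {θ : EuclideanSpace ℝ (Fin p)} {R : Matrix (Fin p) (Fin p) ℝ}
    (hR : R * Rᵀ = 1) (hRθ : R *ᵥ Pi.single 0 1 = θ.ofLp) {r v : ℝ} (hrv : 0 ≤ 1 + r * v) (n : ℕ) :
    sampleLaw n θ r v = (seqLaw p).map fun ω (i : Fin n) =>
      toEuclideanCLM (𝕜 := ℝ) (R * spikeDiag √(1 + r * v)) (ω i) := by
  have h1 := Measure.map_infinitePi_infinitePi_of_inj
    (P := fun _ : ℕ => stdGaussian (EuclideanSpace ℝ (Fin p))) (f := ((↑) : Fin n → ℕ))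
    Fin.val_injective
  rw [Measure.infinitePi_eq_pi (μ := fun _ : Fin n => stdGaussian (EuclideanSpace ℝ (Fin p)))] at h1
  have h2 : (fun (ω : ℕ → EuclideanSpace ℝ (Fin p)) (i : Fin n) =>
      toEuclideanCLM (𝕜 := ℝ) (R * spikeDiag √(1 + r * v)) (ω i)) =
      (fun (g : Fin n → EuclideanSpace ℝ (Fin p)) i =>
        toEuclideanCLM (𝕜 := ℝ) (R * spikeDiag √(1 + r * v)) (g i)) ∘ fun ω i => ω i := rfl
  rw [h2, ← Measure.map_map (by fun_prop) (by fun_prop), seqLaw, h1,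
    sampleLaw, spikedCov_eq hR hRθ hrv, multivariateGaussian_mul_transpose,
    ← Measure.pi_map_pi (fun _ => by fun_prop)]

theorem QA_eq_andersonStat {θ : EuclideanSpace ℝ (Fin p)} {R : Matrix (Fin p) (Fin p) ℝ}
    (hR : R * Rᵀ = 1) (hRθ : R *ᵥ Pi.single 0 1 = θ.ofLp) (n : ℕ)
    (x : Fin n → EuclideanSpace ℝ (Fin p)) :
    QA n θ x = andersonStat n (Rᵀ * sampleCov x * R) := by
  have hR' : Rᵀ * R = 1 := mul_eq_one_comm.mp hR
  have htop : topEig (Rᵀ * sampleCov x * R) = eigval (sampleCov x) 0 := by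
    have := topEig_mul_mul_transpose (sampleCov x) Rᵀ (by rwa [transpose_transpose])
    rw [transpose_transpose] at this
    rw [this, topEig_eq_eigval (isHermitian_of_isSymm (isSymm_sampleCov x))]
  have hinv : (Rᵀ * sampleCov x * R)⁻¹ = Rᵀ * (sampleCov x)⁻¹ * R := by
    rw [Matrix.mul_inv_rev, Matrix.mul_inv_rev, inv_eq_left_inv hR', inv_eq_left_inv hR,
      Matrix.mul_assoc]
  have hentry : ∀ M : Matrix (Fin p) (Fin p) ℝ, (Rᵀ * M * R) 0 0 = θ.ofLp ⬝ᵥ (M *ᵥ θ.ofLp) := by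
    intro M
    have h00 : (Rᵀ * M * R) 0 0 = Pi.single 0 1 ⬝ᵥ ((Rᵀ * M * R) *ᵥ Pi.single 0 1) := by simp
    rw [h00, ← mulVec_mulVec, ← mulVec_mulVec, dotProduct_mulVec, ← mulVec_transpose,
      transpose_transpose, hRθ]
  rw [andersonStat, htop, hinv, hentry, hentry, QA]

theorem QA_toEuclideanCLM {θ : EuclideanSpace ℝ (Fin p)} {R : Matrix (Fin p) (Fin p) ℝ}
    (hR : R * Rᵀ = 1) (hRθ : R *ᵥ Pi.single 0 1 = θ.ofLp) {n : ℕ} (hn : 0 < n) (ρ : ℝ)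
    (g : Fin n → EuclideanSpace ℝ (Fin p)) :
    QA n θ (fun i => toEuclideanCLM (𝕜 := ℝ) (R * spikeDiag √(1 + ρ)) (g i)) =
      andersonStat (√n ^ 2) (spikedScatter √n ρ (unvec (scaledCov g))) := by
  have hR' : Rᵀ * R = 1 := mul_eq_one_comm.mp hR
  have hDT : (spikeDiag (p := p) √(1 + ρ))ᵀ = spikeDiag √(1 + ρ) := by simp [spikeDiag]
  rw [QA_eq_andersonStat hR hRθ, sampleCov_toEuclideanCLM, Real.sq_sqrt n.cast_nonneg,
    spikedScatter, ← sampleCov_eq_one_add_scaledCov hn, transpose_mul, hDT]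
  congr 1
  calc Rᵀ * (R * spikeDiag √(1 + ρ) * sampleCov g * (spikeDiag √(1 + ρ) * Rᵀ)) * R
      = (Rᵀ * R) * spikeDiag √(1 + ρ) * sampleCov g * spikeDiag √(1 + ρ) * (Rᵀ * R) := by
        simp only [Matrix.mul_assoc]
    _ = _ := by rw [hR', Matrix.one_mul, Matrix.mul_one]

theorem measurable_andersonStat_comp {Ω : Type*} [TopologicalSpace Ω] [MeasurableSpace Ω]
    [OpensMeasurableSpace Ω] {A : Ω → Matrix (Fin p) (Fin p) ℝ} (hA : Continuous A) (c : ℝ) :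
    Measurable fun x => andersonStat c (A x) := by
  have h1 : Measurable fun x => topEig (A x) := (continuous_topEig.comp hA).measurable
  have h2 : Measurable fun x => A x 0 0 := (hA.matrix_elem 0 0).measurable
  have h3 : Measurable fun x => (A x)⁻¹ 0 0 := by
    simp only [inv_def, Ring.inverse_eq_inv', Matrix.smul_apply, smul_eq_mul]
    exact hA.matrix_det.measurable.inv.mul (hA.matrix_adjugate.matrix_elem 0 0).measurable
  exact (((h1.mul h3).add (h1.inv.mul h2)).sub_const 2).const_mul c

/-- Measurability goes through the rotated form, where the largest eigenvalue is the continuous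
function `topEig` and the inverse is an adjugate over a determinant. -/
theorem measurable_QA {θ : EuclideanSpace ℝ (Fin p)} (hθ : ‖θ‖ = 1) (n : ℕ) :
    Measurable (QA n θ) := by
  obtain ⟨R, hR, hRθ⟩ := exists_orthogonal_mulVec_single hθ
  have : QA n θ = fun x => andersonStat n (Rᵀ * sampleCov x * R) :=
    funext fun x => QA_eq_andersonStat hR hRθ n x
  rw [this]
  refine measurable_andersonStat_comp ?_ _
  exact (continuous_const.matrix_mul (continuous_sampleCov n)).matrix_mul continuous_const

/-- The weak limit of the Anderson statistic, given the limit of the deterministic maps that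
express it through the sample covariance matrix of standard Gaussian vectors. -/
theorem tendstoInDistribution_QA {θ : EuclideanSpace ℝ (Fin p)} (hθ : ‖θ‖ = 1) {v : ℝ}
    (hv : 0 < v) {r : ℕ → ℝ} (hr : ∀ n, 1 ≤ n → 0 < r n)
    {Ω : Type*} [MeasurableSpace Ω] {P : Measure Ω} [IsProbabilityMeasure P]
    {Z : Ω → Matrix (Fin p) (Fin p) ℝ}
    (hZ : HasLaw (fun ω => WithLp.toLp 2 (Z ω).vec)
      (multivariateGaussian 0 (1 + commutationMatrix p)) P)
    {h : Matrix (Fin p) (Fin p) ℝ → ℝ} (hh : Continuous h)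
    (hlim : ∀ (z : EuclideanSpace ℝ (Fin p × Fin p)), Tendsto
      (fun q : ℕ × EuclideanSpace ℝ (Fin p × Fin p) =>
        andersonStat (√(q.1 : ℝ) ^ 2) (spikedScatter √(q.1 : ℝ) (r q.1 * v) (symmPart q.2)))
      (atTop ×ˢ 𝓝 z) (𝓝 (h (symmPart z)))) :
    TendstoInDistribution (fun n => QA n θ) atTop (fun ω => h (Z ω))
      (fun n => sampleLaw n θ (r n) v) P := by
  obtain ⟨R, hR, hRθ⟩ := exists_orthogonal_mulVec_single hθ
  have hsymm : ∀ᵐ ω ∂P, (Z ω).IsSymm := by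
    have h1 : ∀ᵐ x ∂P.map (fun ω => WithLp.toLp 2 (Z ω).vec), (unvec x).IsSymm := by
      rw [hZ.map_eq]
      exact (ae_det_powerTraces_ne_zero 0).mono fun x hx => hx.1
    exact (ae_of_ae_map hZ.aemeasurable h1)
  have hcts : ∀ n : ℕ, Measurable fun x : EuclideanSpace ℝ (Fin p × Fin p) =>
      andersonStat (√(n : ℝ) ^ 2) (spikedScatter √(n : ℝ) (r n * v) (symmPart x)) := by
    intro n
    refine measurable_andersonStat_comp ?_ _
    have := continuous_symmPart (p := p)
    unfold spikedScatter
    fun_prop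
  have hlimm : AEMeasurable (fun ω => h (symmPart (WithLp.toLp 2 (Z ω).vec))) P :=
    (hh.comp continuous_symmPart).measurable.comp_aemeasurable hZ.aemeasurable
  have hmeas : ∀ n, Measurable fun ω : ℕ → EuclideanSpace ℝ (Fin p) =>
      scaledCov fun i : Fin n => ω i := fun n =>
    (continuous_scaledCov n).measurable.comp (by fun_prop)
  have hT := tendstoInDistribution_comp_of_tendsto (tendstoInDistribution_scaledCov hZ)
    (f := fun n x =>
      andersonStat (√(n : ℝ) ^ 2) (spikedScatter √(n : ℝ) (r n * v) (symmPart x)))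
    (h := fun x => h (symmPart x)) (fun n => ((hcts n).comp (hmeas n)).aemeasurable) hlimm
    (ae_of_all _ fun ω => hlim _)
  have hT' := hT.congr (fun n => ae_eq_rfl) (show _ =ᵐ[P] fun ω => h (Z ω) from by
    filter_upwards [hsymm] with ω hω
    rw [symmPart_eq_unvec (by rwa [unvec_toLp_vec]), unvec_toLp_vec])
  refine ⟨fun n => (measurable_QA hθ n).aemeasurable, hT'.aemeasurable_limit, ?_⟩
  -- The laws agree only for `n ≥ 1`: `r 0` is unconstrained and the scaling by `(√n)⁻¹` degenerates
  -- at `n = 0`.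
  refine hT'.tendsto.congr' ?_
  filter_upwards [eventually_ge_atTop 1] with n hn
  refine Subtype.ext ?_
  have hrv : 0 ≤ 1 + r n * v := by
    have := mul_pos (hr n hn) hv
    linarith
  show _ = (sampleLaw n θ (r n) v).map (QA n θ)
  rw [sampleLaw_eq_map hR hRθ hrv, Measure.map_map (measurable_QA hθ n) (by fun_prop)]
  refine congrArg (fun f => (seqLaw p).map f) (funext fun ω => ?_)
  rw [Function.comp_apply, QA_toEuclideanCLM hR hRθ hn,
    symmPart_eq_unvec (isSymm_unvec_scaledCov _)]

/-! ### Asymptotic size of the test -/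

/-- If the Anderson statistic converges to `limitStat (spiked Z κ)`, the Anderson test has the wrong
asymptotic size. -/
theorem not_andersonHasAsymptoticSize (hp : 2 ≤ p) {θ : EuclideanSpace ℝ (Fin p)} {v κ : ℝ}
    {r : ℕ → ℝ} {Ω : Type*} [MeasurableSpace Ω] {P : Measure Ω} [IsProbabilityMeasure P]
    {Z : Ω → Matrix (Fin p) (Fin p) ℝ}
    (hZ : HasLaw (fun ω => WithLp.toLp 2 (Z ω).vec)
      (multivariateGaussian 0 (1 + commutationMatrix p)) P)
    (hQ : TendstoInDistribution (fun n => QA n θ) atTop (fun ω => limitStat (spiked (Z ω) κ))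
      (fun n => sampleLaw n θ (r n) v) P) {α : ℝ} (hα : α ∈ Set.Ioo (0 : ℝ) 1) :
    ¬ AndersonHasAsymptoticSize θ r v α := by
  intro hsize
  have : NeZero (p - 1) := ⟨by omega⟩
  set c := chiSquareUpperQuantile (p - 1) α with hc
  -- The open-set half of the portmanteau theorem suffices: it bounds the limiting probability above
  -- `c` by `α`, whereas `chiSquare_Ioi_lt` makes it strictly larger. Continuity of the limit law is
  -- not needed.
  have h1 := ProbabilityMeasure.le_liminf_measure_open_of_tendsto hQ.tendsto (isOpen_Ioi (a := c))
  simp only [ProbabilityMeasure.coe_mk] at h1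
  rw [Measure.map_apply_of_aemeasurable hQ.aemeasurable_limit measurableSet_Ioi] at h1
  simp_rw [Measure.map_apply_of_aemeasurable (hQ.forall_aemeasurable _)
    (measurableSet_Ioi (a := c))] at h1
  have h2 : Tendsto (fun n => sampleLaw n θ (r n) v (QA n θ ⁻¹' Set.Ioi c)) atTop
      (𝓝 (ENNReal.ofReal α)) := by
    have := (ENNReal.continuous_ofReal.tendsto α).comp hsize
    refine this.congr fun n => ?_
    rw [Function.comp, ofReal_measureReal]
    rfl
  rw [h2.liminf_eq] at h1
  have h3 := chiSquare_Ioi_lt hp (v := κ) (chiSquareUpperQuantile_pos (k := p - 1) hα)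
  rw [chiSquare_Ioi_upperQuantile hα] at h3
  have h4 : P ((fun ω => limitStat (spiked (Z ω) κ)) ⁻¹' Set.Ioi c) =
      (multivariateGaussian 0 (1 + commutationMatrix p))
        {x | c < limitStat (spiked (unvec x) κ)} := by
    have hopen : IsOpen {x : EuclideanSpace ℝ (Fin p × Fin p) |
        c < limitStat (spiked (unvec x) κ)} :=
      isOpen_lt continuous_const (continuous_limitStat.comp (continuous_spiked κ))
    rw [← hZ.map_eq, Measure.map_apply_of_aemeasurable hZ.aemeasurable hopen.measurableSet]
    rfl
  rw [h4] at h1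
  exact absurd h1 (not_le.mpr h3)

theorem andersonHasAsymptoticSize_of_tendsto (hp : 2 ≤ p) {θ : EuclideanSpace ℝ (Fin p)} {v : ℝ}
    {r : ℕ → ℝ} (hQ : TendstoInDistribution (fun n => QA n θ) atTop (id : ℝ → ℝ)
      (fun n => sampleLaw n θ (r n) v) (chiSquare (p - 1))) {α : ℝ}
    (hα : α ∈ Set.Ioo (0 : ℝ) 1) : AndersonHasAsymptoticSize θ r v α := by
  have : NeZero (p - 1) := ⟨by omega⟩
  set c := chiSquareUpperQuantile (p - 1) α with hc
  -- The frontier of the rejection region is the single point `c`, which the chi-square law does not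
  -- charge.
  have h1 := ProbabilityMeasure.tendsto_measure_of_null_frontier_of_tendsto' hQ.tendsto
    (E := Set.Ioi c) (by simp [Measure.map_id])
  simp only [ProbabilityMeasure.coe_mk, Measure.map_id] at h1
  simp_rw [Measure.map_apply_of_aemeasurable (hQ.forall_aemeasurable _)
    (measurableSet_Ioi (a := c))] at h1
  rw [chiSquare_Ioi_upperQuantile hα] at h1
  have h2 := (ENNReal.tendsto_toReal ENNReal.ofReal_ne_top).comp h1
  rw [ENNReal.toReal_ofReal hα.1.le] at h2
  exact h2

end

/-! ### Limits in the different regimes -/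

section

variable {p : ℕ} [NeZero p] {θ : EuclideanSpace ℝ (Fin p)} {v : ℝ} {r : ℕ → ℝ}
  {Ω : Type*} [MeasurableSpace Ω] {P : Measure Ω}
  {Z : Ω → Matrix (Fin p) (Fin p) ℝ}

theorem tendsto_sqrt_natCast_atTop : Tendsto (fun n : ℕ => √(n : ℝ)) atTop atTop :=
  Real.tendsto_sqrt_atTop.comp tendsto_natCast_atTop_atTop

theorem ae_isSymm_and_injective_eigval
    (hZ : HasLaw (fun ω => WithLp.toLp 2 (Z ω).vec)
      (multivariateGaussian 0 (1 + commutationMatrix p)) P) (κ : ℝ) :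
    ∀ᵐ ω ∂P, (spiked (Z ω) κ).IsHermitian ∧ Function.Injective (eigval (spiked (Z ω) κ)) := by
  have h1 : ∀ᵐ x ∂P.map (fun ω => WithLp.toLp 2 (Z ω).vec),
      (unvec x).IsSymm ∧ (powerTraces (spiked (unvec x) κ)).det ≠ 0 := by
    rw [hZ.map_eq]
    exact ae_det_powerTraces_ne_zero κ
  filter_upwards [ae_of_ae_map hZ.aemeasurable h1] with ω hω
  rw [unvec_toLp_vec] at hω
  have hH : (spiked (Z ω) κ).IsHermitian := isHermitian_of_isSymm (isSymm_spiked hω.1 κ)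
  exact ⟨hH, (eigval_injective_iff hH).mpr hω.2⟩

theorem ae_unitEigenvector_eq_or_eq_neg
    (hZ : HasLaw (fun ω => WithLp.toLp 2 (Z ω).vec)
      (multivariateGaussian 0 (1 + commutationMatrix p)) P) (κ : ℝ) :
    ∀ᵐ ω ∂P, ∀ j u u', IsUnitEigenvector (spiked (Z ω) κ) (eigval (spiked (Z ω) κ) j) u →
      IsUnitEigenvector (spiked (Z ω) κ) (eigval (spiked (Z ω) κ) j) u' → u' = u ∨ u' = -u := by
  filter_upwards [ae_isSymm_and_injective_eigval hZ κ] with ω ⟨hH, hinj⟩ j u u' hu hu'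
  obtain ⟨b, hb, -⟩ := exists_eigenbasis hH
  rcases hu.eq_or_eq_neg_basis hH hinj hb with h | h <;>
    rcases hu'.eq_or_eq_neg_basis hH hinj hb with h' | h' <;> simp [h, h']

variable [IsProbabilityMeasure P]

theorem tendstoInDistribution_QA_of_contiguous (hθ : ‖θ‖ = 1) (hv : 0 < v)
    (hr : ∀ n, 1 ≤ n → 0 < r n)
    (hZ : HasLaw (fun ω => WithLp.toLp 2 (Z ω).vec)
      (multivariateGaussian 0 (1 + commutationMatrix p)) P) {κ : ℝ}
    (hκ : Tendsto (fun n : ℕ => √(n : ℝ) * (r n * v)) atTop (𝓝 κ)) :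
    TendstoInDistribution (fun n => QA n θ) atTop (fun ω => limitStat (spiked (Z ω) κ))
      (fun n => sampleLaw n θ (r n) v) P := by
  refine tendstoInDistribution_QA hθ hv hr hZ (h := fun A => limitStat (spiked A κ)) ?_ ?_
  · exact continuous_limitStat.comp (continuous_id.add continuous_const)
  · intro z
    exact tendsto_andersonStat_of_contiguous (tendsto_sqrt_natCast_atTop.comp tendsto_fst)
      (hκ.comp tendsto_fst) ((continuous_symmPart.tendsto z).comp tendsto_snd)
      fun q => isSymm_symmPart q.2

/-- The eigenvectors `w` may be chosen without measurability: almost surely the spectrum is simple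
and the sum coincides with the continuous functional `limitStat`. -/
theorem TendstoInDistribution.andersonLimit
    (hZ : HasLaw (fun ω => WithLp.toLp 2 (Z ω).vec)
      (multivariateGaussian 0 (1 + commutationMatrix p)) P) {κ : ℝ}
    (hQ : TendstoInDistribution (fun n => QA n θ) atTop (fun ω => limitStat (spiked (Z ω) κ))
      (fun n => sampleLaw n θ (r n) v) P) {w : Fin p → Ω → EuclideanSpace ℝ (Fin p)}
    (hw : ∀ᵐ ω ∂P, ∀ j,
      IsUnitEigenvector (spiked (Z ω) κ) (eigval (spiked (Z ω) κ) j) (w j ω)) :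
    TendstoInDistribution (fun n => QA n θ) atTop
      (fun ω => andersonLimit (spiked (Z ω) κ) (fun j => w j ω))
      (fun n => sampleLaw n θ (r n) v) P := by
  refine hQ.congr (fun n => ae_eq_rfl) ?_
  filter_upwards [ae_isSymm_and_injective_eigval hZ κ, hw] with ω ⟨hH, hinj⟩ hω
  exact (andersonLimit_eq_limitStat hH hinj hω).symm

theorem tendstoInDistribution_QA_chiSquare (hθ : ‖θ‖ = 1) (hv : 0 < v)
    (hr : ∀ n, 1 ≤ n → 0 < r n)
    (hZ : HasLaw (fun ω => WithLp.toLp 2 (Z ω).vec)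
      (multivariateGaussian 0 (1 + commutationMatrix p)) P) {ρ : ℝ}
    (hρ : Tendsto (fun n => r n * v) atTop (𝓝 ρ))
    (hs : Tendsto (fun n : ℕ => √(n : ℝ) * (r n * v)) atTop atTop) :
    TendstoInDistribution (fun n => QA n θ) atTop (id : ℝ → ℝ)
      (fun n => sampleLaw n θ (r n) v) (chiSquare (p - 1)) := by
  have hT := tendstoInDistribution_QA hθ hv hr hZ
    (h := fun A => ∑ j ∈ Finset.univ.erase 0, A j 0 ^ 2) (by fun_prop) fun z =>
      tendsto_andersonStat_of_spike (tendsto_sqrt_natCast_atTop.comp tendsto_fst)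
        (hρ.comp tendsto_fst) (hs.comp tendsto_fst)
        ((continuous_symmPart.tendsto z).comp tendsto_snd) fun q => isSymm_symmPart q.2
  have hm : Continuous fun x : EuclideanSpace ℝ (Fin p × Fin p) =>
      ∑ j ∈ Finset.univ.erase 0, unvec x j 0 ^ 2 := by
    have := continuous_unvec (p := p)
    fun_prop
  have hlaw : P.map (fun ω => ∑ j ∈ Finset.univ.erase 0, Z ω j 0 ^ 2) =
      (chiSquare (p - 1)).map id := by
    rw [Measure.map_id, ← map_sum_sq_first_column, ← hZ.map_eq,
      AEMeasurable.map_map_of_aemeasurable hm.aemeasurable hZ.aemeasurable]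
    rfl
  refine ⟨hT.forall_aemeasurable, aemeasurable_id, ?_⟩
  have hlim := hT.tendsto
  rwa [show (⟨P.map _, _⟩ : ProbabilityMeasure ℝ) = ⟨(chiSquare (p - 1)).map id, _⟩ from
    Subtype.ext hlaw] at hlim

end

end

end AndersonPCA

open AndersonPCA in
theorem theorem3p2 {p : ℕ} [NeZero p] (hp : 2 ≤ p)
    (θ : EuclideanSpace ℝ (Fin p)) (hθ : ‖θ‖ = 1)
    (v : ℝ) (hv : 0 < v)
    (r : ℕ → ℝ) (hr_pos : ∀ n, 1 ≤ n → 0 < r n) (hr_bdd : ∃ C, ∀ n, 1 ≤ n → r n ≤ C)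
    {Ω : Type*} [MeasurableSpace Ω] (P : Measure Ω) [IsProbabilityMeasure P]
    (Z : Ω → Matrix (Fin p) (Fin p) ℝ)
    (hZ : HasLaw (fun ω => WithLp.toLp 2 (Z ω).vec)
      (multivariateGaussian 0 (1 + commutationMatrix p)) P) :
    -- away from, or above, contiguity
    (((∀ n, 1 ≤ n → r n = 1) ∨
        (Tendsto r atTop (𝓝 0) ∧ Tendsto (fun n : ℕ => √(n : ℝ) * r n) atTop atTop)) →
      TendstoInDistribution (fun n => QA n θ) atTop (id : ℝ → ℝ)
          (fun n => sampleLaw n θ (r n) v) (chiSquare (p - 1)) ∧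
        ∀ α ∈ Set.Ioo (0 : ℝ) 1, AndersonHasAsymptoticSize θ r v α) ∧
    -- under contiguity
    ((∀ n : ℕ, 1 ≤ n → r n = 1 / √(n : ℝ)) →
      (∀ᵐ ω ∂P, ∀ j u u', IsUnitEigenvector (spiked (Z ω) v) (eigval (spiked (Z ω) v) j) u →
        IsUnitEigenvector (spiked (Z ω) v) (eigval (spiked (Z ω) v) j) u' →
        u' = u ∨ u' = -u) ∧
      (∀ w : Fin p → Ω → EuclideanSpace ℝ (Fin p),
        (∀ᵐ ω ∂P, ∀ j,
          IsUnitEigenvector (spiked (Z ω) v) (eigval (spiked (Z ω) v) j) (w j ω)) →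
        TendstoInDistribution (fun n => QA n θ) atTop
          (fun ω => andersonLimit (spiked (Z ω) v) (fun j => w j ω))
          (fun n => sampleLaw n θ (r n) v) P) ∧
      ∀ α ∈ Set.Ioo (0 : ℝ) 1, ¬ AndersonHasAsymptoticSize θ r v α) ∧
    -- under strict contiguity
    ((r =o[atTop] fun n : ℕ => 1 / √(n : ℝ)) →
      (∀ w : Fin p → Ω → EuclideanSpace ℝ (Fin p),
        (∀ᵐ ω ∂P, ∀ j, IsUnitEigenvector (Z ω) (eigval (Z ω) j) (w j ω)) →
        TendstoInDistribution (fun n => QA n θ) atTop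
          (fun ω => andersonLimit (Z ω) (fun j => w j ω))
          (fun n => sampleLaw n θ (r n) v) P) ∧
      ∀ α ∈ Set.Ioo (0 : ℝ) 1, ¬ AndersonHasAsymptoticSize θ r v α) := by
  refine ⟨fun h => ?_, fun h => ?_, fun h => ?_⟩
  · have hQ : TendstoInDistribution (fun n => QA n θ) atTop (id : ℝ → ℝ)
        (fun n => sampleLaw n θ (r n) v) (chiSquare (p - 1)) := by
      rcases h with h | ⟨h0, hs⟩
      · have hev : ∀ᶠ n in atTop, v = r n * v := by
          filter_upwards [eventually_ge_atTop 1] with n hn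
          rw [h n hn, one_mul]
        refine tendstoInDistribution_QA_chiSquare hθ hv hr_pos hZ
          (tendsto_const_nhds.congr' hev) ?_
        exact (tendsto_sqrt_natCast_atTop.atTop_mul_const hv).congr'
          (hev.mono fun n hn => congrArg _ hn)
      · refine tendstoInDistribution_QA_chiSquare hθ hv hr_pos hZ (h0.mul_const v) ?_
        exact (hs.atTop_mul_const hv).congr fun n => mul_assoc _ _ _
    exact ⟨hQ, fun α hα => andersonHasAsymptoticSize_of_tendsto hp hQ hα⟩
  · have hQ := tendstoInDistribution_QA_of_contiguous hθ hv hr_pos hZ (κ := v) <| by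
      refine tendsto_const_nhds.congr' ?_
      filter_upwards [eventually_ge_atTop 1] with n hn
      have : √(n : ℝ) ≠ 0 := (Real.sqrt_pos.mpr (by exact_mod_cast hn)).ne'
      rw [h n hn]
      field_simp
    exact ⟨ae_unitEigenvector_eq_or_eq_neg hZ v,
      fun w hw => TendstoInDistribution.andersonLimit hZ hQ hw,
      fun α hα => not_andersonHasAsymptoticSize hp hZ hQ hα⟩
  -- The strictly contiguous regime is the contiguous one with `κ = 0`, where the spike disappears
  -- from the limit.
  · have hQ := tendstoInDistribution_QA_of_contiguous hθ hv hr_pos hZ (κ := 0) <| by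
      have := h.tendsto_div_nhds_zero.mul_const v
      rw [zero_mul] at this
      refine this.congr fun n => ?_
      rw [div_div_eq_mul_div, div_one]
      ring
    have h0 : ∀ A : Matrix (Fin p) (Fin p) ℝ, spiked A 0 = A := fun A => by simp [spiked]
    refine ⟨fun w hw => ?_, fun α hα => not_andersonHasAsymptoticSize hp hZ hQ hα⟩
    have := TendstoInDistribution.andersonLimit hZ hQ (w := w) (by simpa only [h0] using hw)
    simpa only [h0] using this
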